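/- Let $F_n$ ($n\ge 1$) be the flower graph: a central vertex together with $n$ petals, each petal consisting of two vertices joined by an edge and each joined to the central vertex by an edge. Let $\hat F_n$ be $F_n$ with the two vertices of one petal designated as sinks; it has $2n-1$ non-sink vertices. A configuration assigns to each vertex a nonnegative number of particles. A non-sink vertex is unstable if it holds at least as many particles as its degree; toppling it sends one particle along each incident edge. Sinks never topple, and particles reaching a sink are lost. Write $\eta^\circ$ for the stabilization on $\hat F_n$ of $\eta$, obtained by toppling unstable vertices one after another until none is left. On $F_n$ (no sinks), let $(\sigma_t(v))_{t\ge 0}$ be independent Poisson processes of intensity $1$, one for each vertex $v$, let $\Lambda_c=\sup\{t\ge 0:\sigma_t \text{ stabilizes on } F_n\}$, where a configuration stabilizes if repeated simultaneous toppling of all unstable vertices eventually stops, and let $\zeta_c(F_n)=\mathbb E\,\Lambda_c$ be the threshold density. In the driven sandpile on $\hat F_n$, particles arrive at rate $1$ independently at each non-sink vertex, and the sandpile is stabilized after each arrival. A stable configuration is recurrent if, from every stable initial state, it is almost surely visited. The stationary density $\zeta_s(\hat F_n)$ is the expectation, under the uniform measure on recurrent configurations $\eta$, of the density $\frac1{2n-1}\sum_{v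 \text{ non-sink}}\eta(v)$. For $\lambda>0$ let $\sigma_\lambda$ have independent Poisson$(\lambda)$ heights at the non-sink vertices of $\hat F_n$, and let $\rho_n(\lambda)=\frac{1}{2n-1}\sum_{v\text{ non-sink}}(\sigma_\lambda)^\circ(v)$ be the final density. **Theorem.** The equation $\zeta=\frac53+\frac13e^{-3\zeta}$ has a unique positive root $\zeta_c$, and: 1. $\lim_{n\to\infty}\zeta_c(F_n)=\zeta_c$. 2. $\lim_{n\to\infty}\zeta_s(\hat F_n)=\frac53$. 3. For every $\lambda>0$, $\rho_n(\lambda)\to\rho(\lambda)$ in probability as $n\to\infty$, where $$\rho(\lambda)=\min\Bigl(\lambda,\ \tfrac53+\tfrac13e^{-3\lambda}\Bigr)=\begin{cases}\lambda,&\lambda\le\zeta_c,\\ \tfrac53+\tfrac13e^{-3\lambda},&\lambda>\zeta_c.\end{cases}$$ -/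

import Mathlib

open MeasureTheory ProbabilityTheory Filter Topology
open scoped NNReal ENNReal

namespace Sandpile

/-! ### The fixed-energy sandpile (no sinks, parallel toppling) -/

section FixedEnergy

variable {V : Type*} [Fintype V] [DecidableEq V]

/-- The set of unstable vertices of `η`: those holding at least as many particles as their degree. -/
def unstableSet (G : SimpleGraph V) [DecidableRel G.Adj] (η : V → ℕ) : Finset V :=
  Finset.univ.filter fun v => G.degree v ≤ η v

/-- One step of parallel chip-firing: every unstable vertex sends one particle along each
incident edge. The subtraction is exact, since it is only made at unstable vertices. -/
def parallelStep (G : SimpleGraph V) [DecidableRel G.Adj] (η : V → ℕ) : V → ℕ := fun w =>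
  (η w - if w ∈ unstableSet G η then G.degree w else 0)
    + ((unstableSet G η).filter fun v => G.Adj v w).card

/-- `η` stabilizes: the parallel dynamics started from `η` eventually has no toppling. -/
def Stabilizes (G : SimpleGraph V) [DecidableRel G.Adj] (η : V → ℕ) : Prop :=
  ∃ J : ℕ, ∀ j, J ≤ j → unstableSet G ((parallelStep G)^[j] η) = ∅

/-- `Λ_c = sup {t ≥ 0 : the configuration σ t stabilizes}`, as an extended nonnegative number. -/
noncomputable def criticalTime (G : SimpleGraph V) [DecidableRel G.Adj] (σ : V → ℝ≥0 → ℕ) : ℝ≥0∞ :=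
  ⨆ (t : ℝ≥0) (_ : Stabilizes G fun v => σ v t), (t : ℝ≥0∞)

end FixedEnergy

/-! ### Poisson processes -/

/-- `N` is (the counting process of) a Poisson point process of intensity `1` on `[0, ∞)`. -/
structure IsUnitPoissonProcess {Ω : Type*} [MeasurableSpace Ω] (P : Measure Ω)
    (N : ℝ≥0 → Ω → ℕ) : Prop where
  measurable : ∀ t, Measurable (N t)
  zero : ∀ᵐ ω ∂P, N 0 ω = 0
  mono : ∀ᵐ ω ∂P, Monotone fun t => N t ω
  right_continuous : ∀ᵐ ω ∂P, ∀ t, ContinuousWithinAt (fun s => N s ω) (Set.Ici t) t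
  indep_increments : HasIndepIncrements N P
  law_increments : ∀ s t : ℝ≥0, s ≤ t →
    P.map (fun ω => N t ω - N s ω) = poissonMeasure (t - s)

/-- `N` is a family of independent Poisson point processes of intensity `1` indexed by `V`. -/
structure IsPoissonFamily {V Ω : Type*} [MeasurableSpace Ω] (P : Measure Ω)
    (N : V → ℝ≥0 → Ω → ℕ) : Prop where
  process : ∀ v, IsUnitPoissonProcess P (N v)
  indep : iIndepFun (fun v ω t => N v t ω) P

section Threshold

variable {V Ω : Type*} [Fintype V] [DecidableEq V] [MeasurableSpace Ω]

/-- The random variable `Λ_c` for the graph `G`, driven by the processes `N`. -/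
noncomputable def randomThreshold (G : SimpleGraph V) [DecidableRel G.Adj]
    (N : V → ℝ≥0 → Ω → ℕ) : Ω → ℝ≥0∞ :=
  fun ω => criticalTime G fun v t => N v t ω

/-- The threshold density `ζ_c(G) = 𝔼 Λ_c`, computed on a probability space `(Ω, P)` carrying
independent unit Poisson processes `N`. -/
noncomputable def thresholdDensity (G : SimpleGraph V) [DecidableRel G.Adj] (P : Measure Ω)
    (N : V → ℝ≥0 → Ω → ℕ) : ℝ≥0∞ :=
  ∫⁻ ω, randomThreshold G N ω ∂P

end Threshold

/-! ### The driven dissipative sandpile (with a set `S` of sinks) -/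

section Driven

variable {V : Type*} [Fintype V] [DecidableEq V]

/-- The vertices that are not sinks. A sandpile records the heights at these vertices only:
particles that reach a sink have left the system. -/
abbrev Site (S : Finset V) : Type _ := {v : V // v ∉ S}

/-- Topple the site `v`: it loses `deg v` particles (`deg v` counts the edges to sinks as well), and
each neighbouring site gains one. -/
def topple (G : SimpleGraph V) [DecidableRel G.Adj] (S : Finset V) (v : Site S)
    (η : Site S → ℕ) : Site S → ℕ := fun w =>
  (η w - if w = v then G.degree v.1 else 0) + if G.Adj v.1 w.1 then 1 else 0

/-- `η'` results from `η` by one legal toppling, that is, toppling one unstable site. -/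
def LegalStep (G : SimpleGraph V) [DecidableRel G.Adj] (S : Finset V) (η η' : Site S → ℕ) : Prop :=
  ∃ v : Site S, G.degree v.1 ≤ η v ∧ η' = topple G S v η

/-- No site is unstable. -/
def IsStable (G : SimpleGraph V) [DecidableRel G.Adj] (S : Finset V) (η : Site S → ℕ) : Prop :=
  ∀ v : Site S, η v < G.degree v.1

/-- `ξ` is reached from `η` by toppling unstable sites in sequence until all sites are stable. -/
def IsStabilization (G : SimpleGraph V) [DecidableRel G.Adj] (S : Finset V)
    (η ξ : Site S → ℕ) : Prop :=
  Relation.ReflTransGen (LegalStep G S) η ξ ∧ IsStable G S ξ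

open Classical in
/-- The stabilization `η°`. (The value `η` is a placeholder for the case that no stabilization
exists, which does not occur if every vertex is connected to a sink.) -/
noncomputable def stabilize (G : SimpleGraph V) [DecidableRel G.Adj] (S : Finset V)
    (η : Site S → ℕ) : Site S → ℕ :=
  if h : ∃ ξ, IsStabilization G S η ξ then h.choose else η

/-- The density of a sandpile: the average height over the non-sink vertices. -/
noncomputable def density (S : Finset V) (η : Site S → ℕ) : ℝ :=
  (∑ v, (η v : ℝ)) / (Fintype.card (Site S) : ℝ)

/-- The successive states of the driven sandpile started from `ξ`, if the particles are added at
the sites `s 0, s 1, s 2, …`, the sandpile being stabilized after each addition. -/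
noncomputable def drivenChain (G : SimpleGraph V) [DecidableRel G.Adj] (S : Finset V)
    (ξ : Site S → ℕ) (s : ℕ → Site S) : ℕ → Site S → ℕ
  | 0 => ξ
  | k + 1 => stabilize G S (drivenChain G S ξ s k + Pi.single (s k) 1)

/-- The law of the sequence of sites at which particles are added. As particles arrive at rate `1`
at every site independently, the sites of the successive arrivals are independent and uniform. -/
noncomputable def arrivalLaw (S : Finset V) [Nonempty (Site S)] :
    @Measure (ℕ → Site S) (@MeasurableSpace.pi ℕ (fun _ => Site S) fun _ => ⊤) :=
  letI : MeasurableSpace (Site S) := ⊤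
  Measure.infinitePi fun _ : ℕ => (PMF.uniformOfFintype (Site S)).toMeasure

/-- `η` is a recurrent state of the driven sandpile: it is stable and, whatever the (stable)
initial state `ξ`, it is almost surely visited by the chain started from `ξ`. -/
def IsRecurrent (G : SimpleGraph V) [DecidableRel G.Adj] (S : Finset V) [Nonempty (Site S)]
    (η : Site S → ℕ) : Prop :=
  IsStable G S η ∧ ∀ ξ, IsStable G S ξ →
    ∀ᵐ s ∂(arrivalLaw S), ∃ k, drivenChain G S ξ s k = η

/-- The stationary density `ζ_s`: the expected density under the uniform measure on recurrent
sandpiles. -/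
noncomputable def stationaryDensity (G : SimpleGraph V) [DecidableRel G.Adj] (S : Finset V)
    [Nonempty (Site S)] : ℝ :=
  ∫ η, density S η ∂(uniformOn {η : Site S → ℕ | IsRecurrent G S η})

/-- The law of the configuration `σ_r` with independent Poisson(`r`) heights at the sites. -/
noncomputable def poissonConfig (S : Finset V) (r : ℝ≥0) : Measure (Site S → ℕ) :=
  Measure.pi fun _ => poissonMeasure r

/-- The density of the stabilization of `σ`. -/
noncomputable def finalDensity (G : SimpleGraph V) [DecidableRel G.Adj] (S : Finset V)
    (σ : Site S → ℕ) : ℝ :=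
  density S (stabilize G S σ)

end Driven

/-! ### The flower graph -/

/-- Vertices of the flower graph: `none` is the central site, and `some (i, b)`, for `b` a Boolean,
are the two sites of the `i`-th petal. -/
abbrev FlowerVertex (n : ℕ) : Type := Option (Fin n × Bool)

/-- The flower graph `F_n`: the central site is joined to all petal sites, and the two sites of each
petal are joined to each other. -/
def flower (n : ℕ) : SimpleGraph (FlowerVertex n) where
  Adj v w := v ≠ w ∧ (v = none ∨ w = none ∨ v.map Prod.fst = w.map Prod.fst)
  symm := ⟨fun _ _ h => ⟨h.1.symm, by
    rcases h.2 with h | h | h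
    · exact Or.inr (Or.inl h)
    · exact Or.inl h
    · exact Or.inr (Or.inr h.symm)⟩⟩
  loopless := ⟨fun _ h => h.1 rfl⟩

instance (n : ℕ) : DecidableRel (flower n).Adj := fun v w =>
  inferInstanceAs (Decidable (v ≠ w ∧ (v = none ∨ w = none ∨ v.map Prod.fst = w.map Prod.fst)))

/-- The sinks of `F̂_n`: the two sites of one petal (the petal with index `0`). -/
def flowerSinks (n : ℕ) : Finset (FlowerVertex n) :=
  Finset.univ.filter fun v => ∃ p ∈ v, p.1.val = 0

instance (n : ℕ) : Nonempty (Site (flowerSinks n)) := ⟨⟨none, by simp [flowerSinks]⟩⟩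

end Sandpile

/-! The proof rests on one conserved quantity per petal. Toppling a petal site changes the
difference of the petal's two heights by 3, and toppling the center leaves it unchanged, so the
class of the difference in `ZMod 3` never changes. Call a petal balanced if its class is 0. Among
petals with both heights below 2, the nonempty ones are (1,1), which is balanced, and (1,0), (0,1),
which have the two other classes. Hence the class of a nonempty stable petal determines the petal,
and `n` such petals carry exactly `n` plus the number `B` of balanced ones. Nonempty petals carry at
least that many and stable petals at most.

Once the center has toppled, no petal is ever empty again. A later toppling of the center then needs
at least `3n + B` particles, whereas a stable configuration on `F_n` has fewer than that. Thus
stabilization on `F_n` is decided by comparing the total with `3n + B` (`stabilizes_flower_iff`).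
With a sink petal and `m` other petals, a center toppling loses two particles, and the same count
shows that stabilization leaves `min(total, 3m + B)` particles up to an error of 2
(`siteTotal_flowerStabilize`). These arguments apply to any legal sequence of topplings, so the
abelian property is not needed.

For independent Poisson(`λ`) heights a petal is balanced with probability `(1 + 2 exp(-3λ))/3`, by
Fourier analysis on the group of order 3. The law of large numbers replaces the total by `2λn` and
`3n + B` by `2n(5/3 + exp(-3λ)/3)`. This gives the final density at once. It also shows that `P(Λ_c
> t)` tends to 1 below the root and to 0 above it, and an exponential tail bound uniform in `n`
carries this over to the expectation (`tendsto_thresholdDensity`).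

The recurrent configurations are exactly the full ones, parametrized by arbitrary petal classes and
one bit at the center (`isRecurrent_flower_iff`). Under the uniform measure a petal is therefore
balanced with probability exactly 1/3, which gives the different limit 5/3. -/

namespace Sandpile

/-! ### Petal configurations -/

section Petals

variable {I : Type*} [Fintype I]

/-- The class modulo `3` of the difference of the two heights of each petal. -/
def petalClass (p : I × Bool → ℕ) (i : I) : ZMod 3 := (p (i, false) : ZMod 3) - p (i, true)

/-- The number of petals whose two heights are congruent modulo `3`. -/
def balancedOf (x : I → ZMod 3) : ℕ := ∑ i, if x i = 0 then 1 else 0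

/-- The number of petals whose two heights are congruent modulo `3`. -/
def balanced (p : I × Bool → ℕ) : ℕ := balancedOf (petalClass p)

/-- The number of particles on the petals. -/
def petalTotal (p : I × Bool → ℕ) : ℕ := ∑ i, (p (i, false) + p (i, true))

/-- No petal is empty. -/
def PetalsNonempty (p : I × Bool → ℕ) : Prop := ∀ i, 0 < p (i, false) + p (i, true)

omit [Fintype I] in
lemma petalClass_eq_zero_iff (p : I × Bool → ℕ) (i : I) :
    petalClass p i = 0 ↔ p (i, false) % 3 = p (i, true) % 3 := by
  rw [petalClass, sub_eq_zero, ZMod.natCast_eq_natCast_iff']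

lemma balanced_eq (p : I × Bool → ℕ) :
    balanced p = ∑ i, if p (i, false) % 3 = p (i, true) % 3 then 1 else 0 := by
  simp only [balanced, balancedOf, petalClass_eq_zero_iff]

lemma balancedOf_le_card (x : I → ZMod 3) : balancedOf x ≤ Fintype.card I := by
  calc balancedOf x ≤ ∑ _i : I, 1 := Finset.sum_le_sum fun i _ => by split_ifs <;> simp
    _ = Fintype.card I := by simp

lemma balanced_le_card (p : I × Bool → ℕ) : balanced p ≤ Fintype.card I := balancedOf_le_card _

lemma card_add_balanced (p : I × Bool → ℕ) :
    Fintype.card I + balanced p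
      = ∑ i, (1 + if p (i, false) % 3 = p (i, true) % 3 then 1 else 0) := by
  rw [balanced_eq, Finset.sum_add_distrib]; simp

/-- A petal holding a single particle has heights 0 and 1, which are incongruent, so a nonempty
balanced petal holds at least two. The opposite bound for stable petals is `petalTotal_le`. -/
lemma card_add_balanced_le {p : I × Bool → ℕ} (h : PetalsNonempty p) :
    Fintype.card I + balanced p ≤ petalTotal p := by
  rw [card_add_balanced]
  refine Finset.sum_le_sum fun i _ => ?_
  have := h i
  split_ifs <;> omega

lemma petalTotal_le {p : I × Bool → ℕ} (h : ∀ v, p v < 2) :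
    petalTotal p ≤ Fintype.card I + balanced p := by
  rw [card_add_balanced]
  refine Finset.sum_le_sum fun i _ => ?_
  have := h (i, false)
  have := h (i, true)
  split_ifs <;> omega

/-- A petal can become balanced only by receiving a particle, so particles minus balanced petals is
monotone. This makes stabilizability monotone in time and controls the effect of a single arrival.
-/
lemma petalTotal_add_balanced_le {p q : I × Bool → ℕ} (h : p ≤ q) :
    petalTotal p + balanced q ≤ petalTotal q + balanced p := by
  simp only [petalTotal, balanced_eq, ← Finset.sum_add_distrib]
  refine Finset.sum_le_sum fun i _ => ?_
  have h₁ : p (i, false) ≤ q (i, false) := h _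
  have h₂ : p (i, true) ≤ q (i, true) := h _
  split_ifs <;> omega

omit [Fintype I] in
lemma PetalsNonempty.mono {p q : I × Bool → ℕ} (h : PetalsNonempty p) (hpq : p ≤ q) :
    PetalsNonempty q := fun i => by
  have := h i
  have h₁ : p (i, false) ≤ q (i, false) := hpq _
  have h₂ : p (i, true) ≤ q (i, true) := hpq _
  omega

end Petals

/-! ### The flower graph -/

lemma flower_adj_none_some {n : ℕ} (v : Fin n × Bool) : (flower n).Adj none (some v) := by
  simp [flower]

lemma flower_adj_some_none {n : ℕ} (v : Fin n × Bool) : (flower n).Adj (some v) none := by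
  simp [flower]

lemma flower_adj_some_some {n : ℕ} (i j : Fin n) (b c : Bool) :
    (flower n).Adj (some (i, b)) (some (j, c)) ↔ i = j ∧ c = !b := by
  simp only [flower, ne_eq, Option.some.injEq, Prod.mk.injEq, reduceCtorEq, Option.map_some,
    false_or]
  cases b <;> cases c <;> simp

lemma card_filter_flower_adj_none {n : ℕ} (p : FlowerVertex n → Prop) [DecidablePred p] :
    ((Finset.univ.filter p).filter fun v => (flower n).Adj v none).card
      = ∑ i, ((if p (some (i, false)) then 1 else 0) + if p (some (i, true)) then 1 else 0) := by
  rw [Finset.filter_filter, Finset.card_filter, Fintype.sum_option, Fintype.sum_prod_type]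
  simp only [Fintype.sum_bool, flower_adj_some_none, and_true, SimpleGraph.irrefl, and_false,
    if_false, zero_add]
  exact Finset.sum_congr rfl fun _ _ => add_comm _ _

lemma card_filter_flower_adj_some {n : ℕ} (p : FlowerVertex n → Prop) [DecidablePred p]
    (i : Fin n) (b : Bool) :
    ((Finset.univ.filter p).filter fun v => (flower n).Adj v (some (i, b))).card
      = (if p none then 1 else 0) + if p (some (i, !b)) then 1 else 0 := by
  rw [Finset.filter_filter, Finset.card_filter, Fintype.sum_option, Fintype.sum_prod_type,
    Finset.sum_eq_single i]
  · cases b <;> simp only [Fintype.sum_bool, flower_adj_none_some, flower_adj_some_some] <;> simp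
  · intro j _ hj
    simp [flower_adj_some_some, hj]
  · simp

lemma flower_degree_none (n : ℕ) : (flower n).degree none = 2 * n := by
  have := card_filter_flower_adj_none (n := n) fun _ => True
  simp only [SimpleGraph.adj_comm _ _ none] at this
  rw [← SimpleGraph.card_neighborFinset_eq_degree, SimpleGraph.neighborFinset_eq_filter]
  simpa [mul_comm] using this

lemma flower_degree_some {n : ℕ} (v : Fin n × Bool) : (flower n).degree (some v) = 2 := by
  have := card_filter_flower_adj_some (n := n) (fun _ => True) v.1 v.2
  simp only [SimpleGraph.adj_comm _ _ (some _)] at this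
  rw [← SimpleGraph.card_neighborFinset_eq_degree, SimpleGraph.neighborFinset_eq_filter]
  simpa using this

/-! ### Stabilization on the flower graph -/

section FixedEnergyFlower

variable {n : ℕ}

/-- The number of particles of a configuration on the flower graph. -/
def flowerTotal (η : FlowerVertex n → ℕ) : ℕ := η none + petalTotal fun v => η (some v)

lemma mem_unstableSet_none (η : FlowerVertex n → ℕ) :
    none ∈ unstableSet (flower n) η ↔ 2 * n ≤ η none := by
  simp [unstableSet, flower_degree_none]

lemma mem_unstableSet_some (η : FlowerVertex n → ℕ) (v : Fin n × Bool) :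
    some v ∈ unstableSet (flower n) η ↔ 2 ≤ η (some v) := by
  simp [unstableSet, flower_degree_some]

lemma parallelStep_none (η : FlowerVertex n → ℕ) :
    parallelStep (flower n) η none = (η none - if 2 * n ≤ η none then 2 * n else 0)
      + ∑ i, ((if 2 ≤ η (some (i, false)) then 1 else 0)
          + if 2 ≤ η (some (i, true)) then 1 else 0) := by
  simp only [parallelStep, mem_unstableSet_none, flower_degree_none]
  rw [unstableSet, card_filter_flower_adj_none]
  simp only [flower_degree_some]

lemma parallelStep_some (η : FlowerVertex n → ℕ) (i : Fin n) (b : Bool) :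
    parallelStep (flower n) η (some (i, b))
      = (η (some (i, b)) - if 2 ≤ η (some (i, b)) then 2 else 0)
        + ((if 2 * n ≤ η none then 1 else 0) + if 2 ≤ η (some (i, !b)) then 1 else 0) := by
  simp only [parallelStep, mem_unstableSet_some, flower_degree_some]
  rw [unstableSet, card_filter_flower_adj_some]
  simp only [flower_degree_some, flower_degree_none]

lemma parallelStep_petal (η : FlowerVertex n → ℕ) (i : Fin n) :
    parallelStep (flower n) η (some (i, false)) + parallelStep (flower n) η (some (i, true))
        + ((if 2 ≤ η (some (i, false)) then 1 else 0) + if 2 ≤ η (some (i, true)) then 1 else 0)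
      = η (some (i, false)) + η (some (i, true)) + if 2 * n ≤ η none then 2 else 0 := by
  simp only [parallelStep_some, Bool.not_false, Bool.not_true]
  split_ifs <;> omega

lemma flowerTotal_parallelStep (η : FlowerVertex n → ℕ) :
    flowerTotal (parallelStep (flower n) η) = flowerTotal η := by
  have h := Finset.sum_congr rfl fun i (_ : i ∈ Finset.univ) => parallelStep_petal η i
  have h' : ∑ _i : Fin n, (if 2 * n ≤ η none then 2 else 0)
      = if 2 * n ≤ η none then 2 * n else 0 := by
    split_ifs <;> simp [mul_comm]
  simp only [Finset.sum_add_distrib] at h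
  simp only [flowerTotal, petalTotal, parallelStep_none, Finset.sum_add_distrib]
  rw [h'] at h
  split_ifs at h ⊢ <;> omega

lemma balanced_parallelStep (η : FlowerVertex n → ℕ) :
    (balanced fun v => parallelStep (flower n) η (some v)) = balanced fun v => η (some v) := by
  simp only [balanced_eq]
  refine Finset.sum_congr rfl fun i _ => ?_
  simp only [parallelStep_some, Bool.not_false, Bool.not_true]
  congr 1
  rw [eq_iff_iff]
  split_ifs <;> omega

/-- A petal site that topples feeds its partner, so toppling never empties a petal; a toppling
center fills every petal. -/
lemma petalsNonempty_parallelStep {η : FlowerVertex n → ℕ}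
    (h : (PetalsNonempty fun v => η (some v)) ∨ 2 * n ≤ η none) :
    PetalsNonempty fun v => parallelStep (flower n) η (some v) := by
  intro i
  have h : 0 < η (some (i, false)) + η (some (i, true)) ∨ 2 * n ≤ η none := h.imp_left fun h => h i
  simp only [parallelStep_some, Bool.not_false, Bool.not_true]
  split_ifs <;> omega

lemma parallelStep_of_stable {η : FlowerVertex n → ℕ} (h : unstableSet (flower n) η = ∅) :
    parallelStep (flower n) η = η := by
  funext w
  simp [parallelStep, h]

lemma stabilizes_of_iterate {η : FlowerVertex n → ℕ} {j : ℕ}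
    (h : unstableSet (flower n) ((parallelStep (flower n))^[j] η) = ∅) :
    Stabilizes (flower n) η := by
  refine ⟨j, fun k hk => ?_⟩
  obtain ⟨l, rfl⟩ := Nat.exists_eq_add_of_le' hk
  rwa [Function.iterate_add_apply, Function.iterate_fixed (parallelStep_of_stable h)]

lemma stabilizes_parallelStep {η : FlowerVertex n → ℕ}
    (h : Stabilizes (flower n) (parallelStep (flower n) η)) : Stabilizes (flower n) η := by
  obtain ⟨J, hJ⟩ := h
  exact stabilizes_of_iterate (j := J + 1) (hJ J le_rfl)

/-- A property which passes to the successor of a configuration and ensures stability of the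
center also ensures that the configuration stabilizes. -/
lemma stabilizes_of_center (Q : (FlowerVertex n → ℕ) → Prop)
    (hstep : ∀ η, Q η → η none < 2 * n → Q (parallelStep (flower n) η))
    (hQ : ∀ η, Q η → 2 * n ≤ η none → Stabilizes (flower n) η)
    {η : FlowerVertex n → ℕ} (hη : Q η) : Stabilizes (flower n) η := by
  -- The total is conserved, and while the center does not topple every petal toppling sends it a
  -- particle, so the number of particles off the center decreases.
  induction hk : flowerTotal η - η none using Nat.strong_induction_on generalizing η with
  | _ k ih =>
    by_cases hc : 2 * n ≤ η none
    · exact hQ η hη hc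
    by_cases hs : unstableSet (flower n) η = ∅
    · exact stabilizes_of_iterate (j := 0) hs
    refine stabilizes_parallelStep (ih _ ?_ (hstep η hη (not_le.1 hc)) rfl)
    have hlt : η none < parallelStep (flower n) η none := by
      rw [parallelStep_none, if_neg hc, Nat.sub_zero, lt_add_iff_pos_right]
      obtain ⟨v, hv⟩ := Finset.nonempty_iff_ne_empty.2 hs
      obtain _ | ⟨i, b⟩ := v
      · exact absurd ((mem_unstableSet_none η).1 hv) hc
      rw [mem_unstableSet_some] at hv
      refine Finset.sum_pos' (fun _ _ => Nat.zero_le _) ⟨i, Finset.mem_univ _, ?_⟩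
      cases b <;> simp [hv]
    have h₁ : parallelStep (flower n) η none ≤ flowerTotal (parallelStep (flower n) η) :=
      Nat.le_add_right _ _
    rw [flowerTotal_parallelStep] at h₁ ⊢
    omega

/-- The center topples at most once. The outer use of `stabilizes_of_center` runs up to that
toppling; the inner one starts with nonempty petals, where another toppling would require `2n`
particles at the center besides at least `n + B` on the petals. -/
lemma stabilizes_of_lt {η : FlowerVertex n → ℕ}
    (h : flowerTotal η < 3 * n + balanced fun v => η (some v)) : Stabilizes (flower n) η := by
  refine stabilizes_of_center (fun η => flowerTotal η < 3 * n + balanced fun v => η (some v))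
    (fun η hη _ => ?_) (fun η hη hc => stabilizes_parallelStep ?_) h
  · rwa [flowerTotal_parallelStep, balanced_parallelStep]
  refine stabilizes_of_center (fun η => flowerTotal η < 3 * n + (balanced fun v => η (some v)) ∧
    PetalsNonempty fun v => η (some v)) (fun η hη _ => ?_) (fun η hη hc => ?_) ⟨?_, ?_⟩
  · rw [flowerTotal_parallelStep, balanced_parallelStep]
    exact ⟨hη.1, petalsNonempty_parallelStep (Or.inl hη.2)⟩
  · have h₁ := hη.1
    have h₂ := card_add_balanced_le hη.2
    rw [Fintype.card_fin] at h₂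
    rw [flowerTotal] at h₁
    omega
  · rwa [flowerTotal_parallelStep, balanced_parallelStep]
  · exact petalsNonempty_parallelStep (Or.inr hc)

/-- A configuration on the flower graph stabilizes if and only if the number of its particles is
smaller than `3n` plus the number of petals whose heights are congruent modulo `3`. -/
theorem stabilizes_flower_iff (η : FlowerVertex n → ℕ) :
    Stabilizes (flower n) η ↔ flowerTotal η < 3 * n + balanced fun v => η (some v) := by
  refine ⟨fun ⟨J, hJ⟩ => ?_, stabilizes_of_lt⟩
  have hinv : ∀ j, flowerTotal ((parallelStep (flower n))^[j] η) = flowerTotal η ∧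
      (balanced fun v => (parallelStep (flower n))^[j] η (some v))
        = balanced fun v => η (some v) := by
    intro j
    induction j with
    | zero => exact ⟨rfl, rfl⟩
    | succ j ih =>
      rw [Function.iterate_succ_apply', flowerTotal_parallelStep, balanced_parallelStep]
      exact ih
  rw [← (hinv J).1, ← (hinv J).2]
  -- By invariance it suffices to count at a stable time: fewer than `2n` particles at the center
  -- and at most `n + B` on the petals.
  have hs := Finset.eq_empty_iff_forall_notMem.1 (hJ J le_rfl)
  have h₁ := hs none
  have h₂ := petalTotal_le (p := fun v => (parallelStep (flower n))^[J] η (some v)) fun v =>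
    not_le.1 fun hv => hs (some v) ((mem_unstableSet_some _ v).2 hv)
  rw [mem_unstableSet_none] at h₁
  rw [Fintype.card_fin] at h₂
  rw [flowerTotal]
  omega

end FixedEnergyFlower

/-! ### Stabilization on the flower graph with a sink petal -/

section DrivenFlower

variable {m : ℕ}

/-- The non-sink sites of the flower graph with a sink petal. -/
abbrev FlowerSite (m : ℕ) : Type := Site (flowerSinks (m + 1))

/-- The central site. -/
def center (m : ℕ) : FlowerSite m := ⟨none, by simp [flowerSinks]⟩

/-- The sites on the petals other than the sink petal. -/
def petalSite (v : Fin m × Bool) : FlowerSite m :=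
  ⟨some (v.1.succ, v.2), by simp [flowerSinks]⟩

/-- The non-sink sites are the center and the sites on `m` petals. -/
noncomputable def siteEquiv (m : ℕ) : Option (Fin m × Bool) ≃ FlowerSite m :=
  Equiv.ofBijective (fun o => o.elim (center m) petalSite) <| by
    constructor
    · rintro (_ | ⟨i, b⟩) (_ | ⟨j, c⟩) h
      · rfl
      · simp [center, petalSite] at h
      · simp [center, petalSite] at h
      · simpa [petalSite] using h
    · rintro ⟨_ | ⟨i, b⟩, h⟩
      · exact ⟨none, rfl⟩
      · obtain rfl | ⟨j, rfl⟩ := Fin.eq_zero_or_eq_succ i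
        · simp [flowerSinks] at h
        · exact ⟨some (j, b), rfl⟩

@[simp] lemma siteEquiv_none : siteEquiv m none = center m := rfl

@[simp] lemma siteEquiv_some (v : Fin m × Bool) : siteEquiv m (some v) = petalSite v := rfl

lemma forall_site {P : FlowerSite m → Prop} :
    (∀ v, P v) ↔ P (center m) ∧ ∀ v, P (petalSite v) := by
  rw [← (siteEquiv m).forall_congr_right, Option.forall]; rfl

lemma petalSite_injective : Function.Injective (petalSite : Fin m × Bool → FlowerSite m) :=
  (siteEquiv m).injective.comp (Option.some_injective _)

lemma petalSite_ne_center (v : Fin m × Bool) : petalSite v ≠ center m :=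
  (siteEquiv m).injective.ne (Option.some_ne_none v)

lemma degree_center : (flower (m + 1)).degree (center m).1 = 2 * (m + 1) := flower_degree_none _

lemma degree_petalSite (v : Fin m × Bool) : (flower (m + 1)).degree (petalSite v).1 = 2 :=
  flower_degree_some _

/-- The heights on the petals. -/
def petals (η : FlowerSite m → ℕ) : Fin m × Bool → ℕ := fun v => η (petalSite v)

/-- The number of particles. -/
def siteTotal (η : FlowerSite m → ℕ) : ℕ := ∑ v, η v

lemma siteTotal_eq (η : FlowerSite m → ℕ) : siteTotal η = η (center m) + petalTotal (petals η) := by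
  rw [siteTotal, ← (siteEquiv m).sum_comp, Fintype.sum_option, Fintype.sum_prod_type]
  simp [petalTotal, petals, add_comm]

lemma card_flowerSite : Fintype.card (FlowerSite m) = 2 * m + 1 := by
  rw [← Fintype.card_congr (siteEquiv m)]
  simp [mul_comm]

lemma density_eq (η : FlowerSite m → ℕ) :
    density (flowerSinks (m + 1)) η = siteTotal η / (2 * m + 1) := by
  rw [density, card_flowerSite, siteTotal]
  push_cast
  rfl

lemma petalClass_add (p q : Fin m × Bool → ℕ) :
    petalClass (p + q) = petalClass p + petalClass q := by
  funext i
  simp only [petalClass, Pi.add_apply]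
  push_cast
  ring

lemma isStable_flower_iff (η : FlowerSite m → ℕ) :
    IsStable (flower (m + 1)) (flowerSinks (m + 1)) η
      ↔ η (center m) < 2 * (m + 1) ∧ ∀ v, petals η v < 2 := by
  rw [IsStable, forall_site]
  simp only [degree_center, degree_petalSite, petals]

/-- The effect of toppling the center. -/
lemma topple_center (η : FlowerSite m → ℕ) :
    topple (flower (m + 1)) (flowerSinks (m + 1)) (center m) η (center m)
        = η (center m) - 2 * (m + 1) ∧
      petals (topple (flower (m + 1)) (flowerSinks (m + 1)) (center m) η)
        = fun v => petals η v + 1 := by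
  constructor
  · simp [topple, degree_center]
  · funext v
    simp only [petals, topple, if_neg (petalSite_ne_center v), Nat.sub_zero]
    simp [center, petalSite, flower_adj_none_some]

/-- The effect of toppling a petal site. -/
lemma topple_petalSite (η : FlowerSite m → ℕ) (i : Fin m) (b : Bool) :
    topple (flower (m + 1)) (flowerSinks (m + 1)) (petalSite (i, b)) η (center m)
        = η (center m) + 1 ∧
      petals (topple (flower (m + 1)) (flowerSinks (m + 1)) (petalSite (i, b)) η)
        = fun v => (petals η v - if v = (i, b) then 2 else 0) + if v = (i, !b) then 1 else 0 := by
  constructor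
  · simp only [topple, if_neg (petalSite_ne_center _).symm, Nat.sub_zero]
    simp [center, petalSite, flower_adj_some_none]
  · funext ⟨j, c⟩
    simp only [petals, topple, petalSite_injective.eq_iff]
    rw [degree_petalSite]
    simp only [petalSite, flower_adj_some_some, Prod.mk.injEq,
      Fin.succ_inj, eq_comm (a := i)]

/-- The quantities changed by a legal toppling. -/
inductive TopplingEffect (η η' : FlowerSite m → ℕ) : Prop
  | center (h : 2 * (m + 1) ≤ η (center m)) (total : siteTotal η = siteTotal η' + 2)
      (nonempty : PetalsNonempty (petals η')) (cls : petalClass (petals η') = petalClass (petals η))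
      (hc : η (Sandpile.center m) = η' (Sandpile.center m) + 2 * (m + 1))
  | petal (total : siteTotal η = siteTotal η')
      (nonempty : PetalsNonempty (petals η) → PetalsNonempty (petals η'))
      (cls : petalClass (petals η') = petalClass (petals η))
      (hc : η' (Sandpile.center m) = η (Sandpile.center m) + 1)

lemma LegalStep.effect {η η' : FlowerSite m → ℕ}
    (h : LegalStep (flower (m + 1)) (flowerSinks (m + 1)) η η') : TopplingEffect η η' := by
  obtain ⟨v, hv, rfl⟩ := h
  revert hv
  revert v
  rw [forall_site]
  constructor
  · intro hv
    obtain ⟨hc, hp⟩ := topple_center η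
    rw [degree_center] at hv
    refine .center hv ?_ ?_ ?_ ?_
    · rw [siteTotal_eq, siteTotal_eq, hc, hp]
      simp only [petalTotal, Finset.sum_add_distrib, Finset.sum_const, Finset.card_univ,
        Fintype.card_fin, smul_eq_mul]
      omega
    · rw [hp]
      intro i
      simp
    · rw [hp]
      funext i
      simp [petalClass]
    · rw [hc]
      omega
  · rintro ⟨i, b⟩ hv
    obtain ⟨hc, hp⟩ := topple_petalSite η i b
    have hv : 2 ≤ petals η (i, b) := by rwa [degree_petalSite] at hv
    have key : ∀ j, petals (topple (flower (m + 1)) (flowerSinks (m + 1)) (petalSite (i, b)) η)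
        (j, false) + petals (topple (flower (m + 1)) (flowerSinks (m + 1)) (petalSite (i, b)) η)
        (j, true) + (if j = i then 1 else 0) = petals η (j, false) + petals η (j, true) := by
      intro j
      rw [hp]
      by_cases hj : j = i
      · subst hj
        cases b <;> simp <;> omega
      · simp [hj]
    refine .petal ?_ ?_ ?_ hc
    · have := Finset.sum_congr rfl fun j (_ : j ∈ Finset.univ) => key j
      rw [Finset.sum_add_distrib] at this
      simp only [Finset.sum_ite_eq', Finset.mem_univ, if_true] at this
      rw [siteTotal_eq, siteTotal_eq, hc, petalTotal, petalTotal, ← this]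
      omega
    · intro h j
      have h₁ := h j
      rw [hp]
      by_cases hj : j = i
      · subst hj
        cases b <;> simp
      · simpa [hj] using h₁
    · rw [hp]
      funext j
      by_cases hj : j = i
      · subst hj
        have h3 : (3 : ZMod 3) = 0 := rfl
        cases b <;> simp [petalClass, Nat.cast_sub hv] <;> ring_nf <;> simp [h3]
      · simp [petalClass, hj]

/-- The invariant of the sandpile to which `A` particles have been added in total: no particle has
been lost, or no petal is empty and the number of particles is large. -/
def LossInvariant (A : ℕ) (η : FlowerSite m → ℕ) : Prop :=
  siteTotal η = A ∨ PetalsNonempty (petals η) ∧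
    (A ≤ siteTotal η + 2 ∨ 3 * m + balanced (petals η) ≤ siteTotal η)

lemma TopplingEffect.balanced_eq {η η' : FlowerSite m → ℕ} (h : TopplingEffect η η') :
    balanced (petals η') = balanced (petals η) := by
  cases h <;> simp only [balanced, *]

lemma TopplingEffect.siteTotal_le {η η' : FlowerSite m → ℕ} (h : TopplingEffect η η') :
    siteTotal η' ≤ siteTotal η := by
  cases h <;> omega

lemma TopplingEffect.siteTotal_mod {η η' : FlowerSite m → ℕ} (h : TopplingEffect η η') :
    siteTotal η' % 2 = siteTotal η % 2 := by
  cases h <;> omega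

lemma TopplingEffect.petalClass_eq {η η' : FlowerSite m → ℕ} (h : TopplingEffect η η') :
    petalClass (petals η') = petalClass (petals η) := by
  cases h <;> assumption

lemma TopplingEffect.petalsNonempty {η η' : FlowerSite m → ℕ} (h : TopplingEffect η η')
    (hη : PetalsNonempty (petals η)) : PetalsNonempty (petals η') := by
  cases h with
  | center _ _ h => exact h
  | petal _ h => exact h hη

lemma le_siteTotal {η : FlowerSite m → ℕ} (h : PetalsNonempty (petals η)) :
    η (center m) + m + balanced (petals η) ≤ siteTotal η := by
  have := card_add_balanced_le h
  rw [Fintype.card_fin] at this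
  rw [siteTotal_eq]
  omega

/-- The center topples only with `2m + 2` particles, besides at least `m + B` on the petals. Losing
two of these `3m + 2 + B` particles stays within the bound. -/
lemma TopplingEffect.large {η η' : FlowerSite m → ℕ} (h : TopplingEffect η η')
    (hη : PetalsNonempty (petals η)) (hT : 3 * m + balanced (petals η) ≤ siteTotal η) :
    3 * m + balanced (petals η') ≤ siteTotal η' := by
  rw [h.balanced_eq]
  have := le_siteTotal hη
  cases h <;> omega

/-- The first center toppling loses two particles and fills the petals; every later one can occur
only when the total is large enough to remain above `3m + B`. -/
lemma TopplingEffect.lossInvariant {η η' : FlowerSite m → ℕ} (h : TopplingEffect η η') {A : ℕ}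
    (hη : LossInvariant A η) : LossInvariant A η' := by
  obtain hA | ⟨hQ, hA⟩ := hη
  · cases h with
    | center _ ht hQ => exact Or.inr ⟨hQ, by omega⟩
    | petal ht => exact Or.inl (by omega)
  · refine Or.inr ⟨h.petalsNonempty hQ, ?_⟩
    rw [h.balanced_eq]
    have := le_siteTotal hQ
    cases h <;> omega

lemma exists_isStabilization (η : FlowerSite m → ℕ) :
    ∃ ξ, IsStabilization (flower (m + 1)) (flowerSinks (m + 1)) η ξ := by
  -- A petal toppling lowers this by 1. A center toppling changes it by `-4(m+1) + 2(m+1)`, since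
  -- two particles are lost and the center drops by `2(m+1)`. The subtraction is exact because the
  -- center holds at most the total.
  induction hk : 2 * (m + 1) * siteTotal η - η (center m)
    using Nat.strong_induction_on generalizing η with
  | _ k ih =>
    by_cases hs : IsStable (flower (m + 1)) (flowerSinks (m + 1)) η
    · exact ⟨η, .refl, hs⟩
    obtain ⟨v, hv⟩ := not_forall.1 hs
    have hstep : LegalStep (flower (m + 1)) (flowerSinks (m + 1)) η (topple _ _ v η) :=
      ⟨v, not_lt.1 hv, rfl⟩
    suffices h : _ < k by
      obtain ⟨ξ, hξ, hst⟩ := ih _ h _ rfl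
      exact ⟨ξ, .head hstep hξ, hst⟩
    · have h₁ := siteTotal_eq (topple (flower (m + 1)) (flowerSinks (m + 1)) v η)
      have h₂ := siteTotal_eq η
      cases hstep.effect with
      | center h total _ _ hc =>
        rw [total] at hk
        rw [← hk]
        have : 2 * (m + 1) * (siteTotal (topple (flower (m + 1)) (flowerSinks (m + 1)) v η) + 2)
          = 2 * (m + 1) * siteTotal (topple (flower (m + 1)) (flowerSinks (m + 1)) v η)
            + 4 * (m + 1) := by ring
        have h₃ : siteTotal (topple (flower (m + 1)) (flowerSinks (m + 1)) v η)
          ≤ 2 * (m + 1) * siteTotal (topple (flower (m + 1)) (flowerSinks (m + 1)) v η) :=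
          Nat.le_mul_of_pos_left _ (by omega)
        omega
      | petal total _ _ hc =>
        rw [total] at hk h₂
        rw [← hk]
        have h₃ : siteTotal (topple (flower (m + 1)) (flowerSinks (m + 1)) v η)
          ≤ 2 * (m + 1) * siteTotal (topple (flower (m + 1)) (flowerSinks (m + 1)) v η) :=
          Nat.le_mul_of_pos_left _ (by omega)
        omega

/-- Stabilization on the flower graph with a sink petal. -/
noncomputable abbrev flowerStabilize (η : FlowerSite m → ℕ) : FlowerSite m → ℕ :=
  stabilize (flower (m + 1)) (flowerSinks (m + 1)) η

lemma isStabilization_flowerStabilize (η : FlowerSite m → ℕ) :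
    IsStabilization (flower (m + 1)) (flowerSinks (m + 1)) η (flowerStabilize η) := by
  have h := exists_isStabilization η
  rw [flowerStabilize, stabilize, dif_pos h]
  exact h.choose_spec

lemma isStable_flowerStabilize (η : FlowerSite m → ℕ) :
    IsStable (flower (m + 1)) (flowerSinks (m + 1)) (flowerStabilize η) :=
  (isStabilization_flowerStabilize η).2

/-- A property which is preserved by topplings is preserved by stabilization. -/
lemma flowerStabilize_induction {P : (FlowerSite m → ℕ) → Prop}
    (hP : ∀ η η', TopplingEffect η η' → P η → P η') {η : FlowerSite m → ℕ} (h : P η) :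
    P (flowerStabilize η) := by
  have hs := (isStabilization_flowerStabilize η).1
  generalize flowerStabilize η = ξ at hs ⊢
  induction hs with
  | refl => exact h
  | tail _ hstep ih => exact hP _ _ hstep.effect ih

lemma petalClass_flowerStabilize (η : FlowerSite m → ℕ) :
    petalClass (petals (flowerStabilize η)) = petalClass (petals η) :=
  flowerStabilize_induction (P := fun ξ => petalClass (petals ξ) = petalClass (petals η))
    (fun _ _ h hP => h.petalClass_eq.trans hP) rfl

lemma balanced_flowerStabilize (η : FlowerSite m → ℕ) :
    balanced (petals (flowerStabilize η)) = balanced (petals η) := by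
  rw [balanced, petalClass_flowerStabilize, balanced]

lemma siteTotal_flowerStabilize_mod (η : FlowerSite m → ℕ) :
    siteTotal (flowerStabilize η) % 2 = siteTotal η % 2 :=
  flowerStabilize_induction (P := fun ξ => siteTotal ξ % 2 = siteTotal η % 2)
    (fun _ _ h hP => h.siteTotal_mod.trans hP) rfl

lemma siteTotal_flowerStabilize_le (η : FlowerSite m → ℕ) :
    siteTotal (flowerStabilize η) ≤ siteTotal η :=
  flowerStabilize_induction (P := fun ξ => siteTotal ξ ≤ siteTotal η)
    (fun _ _ h hP => h.siteTotal_le.trans hP) le_rfl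

lemma LossInvariant.flowerStabilize {A : ℕ} {η : FlowerSite m → ℕ} (h : LossInvariant A η) :
    LossInvariant A (flowerStabilize η) :=
  flowerStabilize_induction (fun _ _ h hP => h.lossInvariant hP) h

lemma siteTotal_le_of_isStable {η : FlowerSite m → ℕ}
    (h : IsStable (flower (m + 1)) (flowerSinks (m + 1)) η) :
    siteTotal η ≤ 3 * m + 1 + balanced (petals η) := by
  rw [isStable_flower_iff] at h
  have := petalTotal_le h.2
  rw [Fintype.card_fin] at this
  rw [siteTotal_eq]
  omega

/-- Up to a bounded error, the number of particles after stabilization is the minimum of their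
original number and of `3m` plus the number of petals with heights congruent modulo `3`. -/
lemma siteTotal_flowerStabilize (η : FlowerSite m → ℕ) :
    siteTotal (flowerStabilize η) ≤ min (siteTotal η) (3 * m + balanced (petals η)) + 2 ∧
      min (siteTotal η) (3 * m + balanced (petals η)) ≤ siteTotal (flowerStabilize η) + 2 := by
  have h₁ := siteTotal_flowerStabilize_le η
  have h₂ := siteTotal_le_of_isStable (isStable_flowerStabilize η)
  have h₃ : LossInvariant (siteTotal η) (flowerStabilize η) :=
    LossInvariant.flowerStabilize (Or.inl rfl)
  rw [LossInvariant] at h₃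
  rw [balanced_flowerStabilize] at h₂ h₃
  omega

end DrivenFlower

/-! ### Words in sequences of independent uniform letters -/

/-- Almost surely, a given finite word occurs in a sequence of independent uniform letters. -/
lemma ae_exists_word {α : Type*} [Fintype α] [Nonempty α] [MeasurableSpace α]
    [MeasurableSingletonClass α] (L : ℕ) (w : ℕ → α) :
    ∀ᵐ s ∂(Measure.infinitePi fun _ : ℕ => (PMF.uniformOfFintype α).toMeasure),
      ∃ k, ∀ i < L, s (k + i) = w i := by
  obtain rfl | hL := L.eq_zero_or_pos
  · simp
  set μ := Measure.infinitePi fun _ : ℕ => (PMF.uniformOfFintype α).toMeasure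
  -- Disjoint blocks give independent events of equal positive probability, so the second
  -- Borel–Cantelli lemma applies.
  let block : ℕ → Finset ℕ := fun j => Finset.Ico (j * L) ((j + 1) * L)
  let A : ℕ → Set (ℕ → α) := fun j => Set.pi (block j) fun i => {w (i % L)}
  have hA : ∀ j, MeasurableSet (A j) := fun j =>
    MeasurableSet.pi (block j).countable_toSet fun _ _ => measurableSet_singleton _
  have hμA : ∀ j, μ (A j) = ((Fintype.card α : ℝ≥0∞)⁻¹) ^ L := by
    intro j
    rw [Measure.infinitePi_pi _ fun _ _ => measurableSet_singleton _]
    simp only [PMF.toMeasure_apply_singleton _ _ (measurableSet_singleton _),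
      PMF.uniformOfFintype_apply]
    simp [block, add_mul]
  have hdisj : Pairwise (Function.onFun Disjoint block) := by
    intro j k hjk
    rw [Function.onFun, Finset.disjoint_left]
    intro i hi hi'
    simp only [block, Finset.mem_Ico] at hi hi'
    have h₁ := Nat.div_eq_of_lt_le hi.1 hi.2
    have h₂ := Nat.div_eq_of_lt_le hi'.1 hi'.2
    exact hjk (h₁.symm.trans h₂)
  have hind : iIndepSet A μ := by
    rw [iIndepSet_iff_meas_biInter hA]
    intro F
    have : ⋂ j ∈ F, A j = Set.pi (F.biUnion block) fun i => {w (i % L)} := by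
      ext s
      simp only [A, Set.mem_iInter, Set.mem_pi, Finset.mem_coe, Finset.mem_biUnion]
      exact ⟨fun h i ⟨j, hj, hi⟩ => h j hj i hi, fun h j hj i hi => h i ⟨j, hj, hi⟩⟩
    rw [this, Measure.infinitePi_pi _ fun _ _ => measurableSet_singleton _,
      Finset.prod_biUnion fun j _ k _ hjk => hdisj hjk]
    refine Finset.prod_congr rfl fun j _ => ?_
    rw [Measure.infinitePi_pi _ fun _ _ => measurableSet_singleton _]
  have hsum : ∑' j, μ (A j) = ∞ := by
    simp only [hμA]
    refine ENNReal.tsum_const_eq_top_of_ne_zero ?_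
    simp
  have h1 := measure_limsup_eq_one hA hind hsum
  have hae : ∀ᵐ s ∂μ, s ∈ limsup A atTop := by
    rw [← prob_compl_eq_zero_iff (MeasurableSet.measurableSet_limsup hA)] at h1
    exact h1
  filter_upwards [hae] with s hs
  rw [mem_limsup_iff_frequently_mem] at hs
  obtain ⟨j, hj⟩ := hs.exists
  refine ⟨j * L, fun i hi => ?_⟩
  have h := hj (j * L + i) (by simp [block, add_mul, hi])
  simpa [Nat.mod_eq_of_lt hi] using h

/-! ### Recurrent sandpiles on the flower graph with a sink petal -/

section Recurrent

variable {m : ℕ}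

/-- Addition of a particle at `v`, followed by stabilization. -/
noncomputable def flowerStep (η : FlowerSite m → ℕ) (v : FlowerSite m) : FlowerSite m → ℕ :=
  flowerStabilize (η + Pi.single v 1)

/-- The stable configurations without empty petals and with the maximal number of particles,
up to one, for their petal classes. -/
def IsFull (η : FlowerSite m → ℕ) : Prop :=
  IsStable (flower (m + 1)) (flowerSinks (m + 1)) η ∧ PetalsNonempty (petals η) ∧
    3 * m + balanced (petals η) ≤ siteTotal η

lemma siteTotal_add_balanced_le {η ξ : FlowerSite m → ℕ} (h : η ≤ ξ) :
    siteTotal η + balanced (petals ξ) ≤ siteTotal ξ + balanced (petals η) := by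
  have h₁ := petalTotal_add_balanced_le (p := petals η) (q := petals ξ) fun v => h _
  have h₂ : η (center m) ≤ ξ (center m) := h _
  rw [siteTotal_eq, siteTotal_eq]
  omega

lemma siteTotal_add_single (η : FlowerSite m → ℕ) (v : FlowerSite m) :
    siteTotal (η + Pi.single v 1) = siteTotal η + 1 := by
  simp [siteTotal, Finset.sum_add_distrib]

lemma petals_le_add_single (η : FlowerSite m → ℕ) (v : FlowerSite m) :
    petals η ≤ petals (η + Pi.single v 1) := fun w => by simp [petals]

lemma balanced_add_single_le (η : FlowerSite m → ℕ) (v : FlowerSite m) :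
    balanced (petals (η + Pi.single v 1)) ≤ balanced (petals η) + 1 := by
  have h : siteTotal η + balanced (petals (η + Pi.single v 1))
      ≤ siteTotal (η + Pi.single v 1) + balanced (petals η) :=
    siteTotal_add_balanced_le fun w => by simp
  rw [siteTotal_add_single] at h
  omega

/-- An arrival adds one particle and creates at most one balanced petal, so the lower bound survives
the arrival, and `TopplingEffect.large` carries it through the topplings. -/
lemma IsFull.flowerStep {η : FlowerSite m → ℕ} (h : IsFull η) (v : FlowerSite m) :
    IsFull (flowerStep η v) := by
  refine ⟨isStable_flowerStabilize _, flowerStabilize_induction (P := fun ξ =>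
    PetalsNonempty (petals ξ) ∧ 3 * m + balanced (petals ξ) ≤ siteTotal ξ)
    (fun ξ ξ' hstep hξ => ⟨hstep.petalsNonempty hξ.1, hstep.large hξ.1 hξ.2⟩)
    ⟨h.2.1.mono (petals_le_add_single _ _), ?_⟩⟩
  have h₁ := h.2.2
  have h₂ := balanced_add_single_le η v
  rw [siteTotal_add_single]
  omega

lemma LossInvariant.flowerStep {A : ℕ} {η : FlowerSite m → ℕ} (h : LossInvariant A η)
    (v : FlowerSite m) : LossInvariant (A + 1) (flowerStep η v) := by
  refine LossInvariant.flowerStabilize ?_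
  obtain h | ⟨h₁, h₂⟩ := h
  · exact Or.inl (by rw [siteTotal_add_single, h])
  · refine Or.inr ⟨h₁.mono (petals_le_add_single _ _), ?_⟩
    have := balanced_add_single_le η v
    rw [siteTotal_add_single]
    omega

/-- A stable configuration holds at most `3m + 1 + B ≤ 4m + 1` particles, so `4m + 2` additions
force a loss. If only two particles are missing, at least `4m ≥ 3m + B` remain. -/
lemma LossInvariant.isFull {A : ℕ} {η : FlowerSite m → ℕ} (h : LossInvariant A η)
    (hη : IsStable (flower (m + 1)) (flowerSinks (m + 1)) η) (hA : 4 * m + 2 ≤ A) :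
    IsFull η := by
  have h₁ := siteTotal_le_of_isStable hη
  have h₂ := balanced_le_card (petals η)
  rw [Fintype.card_fin] at h₂
  obtain h | ⟨h, h'⟩ := h
  · omega
  · exact ⟨hη, h, by omega⟩

lemma IsFull.siteTotal_eq {η : FlowerSite m → ℕ} (h : IsFull η) :
    siteTotal η = η (center m) + m + balanced (petals η) := by
  have h₁ := le_siteTotal h.2.1
  have h₂ := petalTotal_le ((isStable_flower_iff η).1 h.1).2
  rw [Fintype.card_fin] at h₂
  rw [Sandpile.siteTotal_eq] at h₁ ⊢
  omega

lemma petal_eq_of_class {a b c d : ℕ} (ha : a < 2) (hb : b < 2) (hc : c < 2) (hd : d < 2)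
    (hab : 0 < a + b) (hcd : 0 < c + d) (h : (a : ZMod 3) - b = c - d) : a = c ∧ b = d := by
  interval_cases a <;> interval_cases b <;> interval_cases c <;> interval_cases d <;>
    first | exact ⟨rfl, rfl⟩ | omega | exact absurd h (by decide)

/-- The classes fix the nonempty stable petals, and fullness leaves only `2m` or `2m + 1` at the
center, which parity distinguishes. -/
lemma IsFull.eq {η ξ : FlowerSite m → ℕ} (hη : IsFull η) (hξ : IsFull ξ)
    (hcls : petalClass (petals η) = petalClass (petals ξ))
    (hpar : siteTotal η % 2 = siteTotal ξ % 2) : η = ξ := by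
  have h₁ := hη.siteTotal_eq
  have h₂ := hξ.siteTotal_eq
  have h₃ := (isStable_flower_iff η).1 hη.1
  have h₄ := (isStable_flower_iff ξ).1 hξ.1
  have h₅ : balanced (petals η) = balanced (petals ξ) := congrArg balancedOf hcls
  have h₆ := hη.2.2
  have h₇ := hξ.2.2
  have key : ∀ i, petals η (i, false) = petals ξ (i, false) ∧
      petals η (i, true) = petals ξ (i, true) := fun i =>
    petal_eq_of_class (h₃.2 _) (h₃.2 _) (h₄.2 _) (h₄.2 _) (hη.2.1 i) (hξ.2.1 i) (congrFun hcls i)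
  rw [funext_iff, forall_site]
  refine ⟨by omega, ?_⟩
  rintro ⟨i, b⟩
  cases b
  · exact (key i).1
  · exact (key i).2

lemma petalClass_flowerStep (η : FlowerSite m → ℕ) (v : FlowerSite m) :
    petalClass (petals (flowerStep η v))
      = petalClass (petals η) + petalClass (petals (Pi.single v 1)) := by
  rw [flowerStep, petalClass_flowerStabilize, ← petalClass_add]
  rfl

lemma petalClass_single_center : petalClass (petals (Pi.single (center m) 1)) = 0 := by
  funext i
  simp [petalClass, petals, petalSite_ne_center]

lemma petalClass_single_petalSite (i : Fin m) :
    petalClass (petals (Pi.single (petalSite (i, false)) 1)) = Pi.single i 1 := by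
  funext j
  simp [petalClass, petals, Pi.single_apply, petalSite_injective.eq_iff]

lemma siteTotal_flowerStep_mod (η : FlowerSite m → ℕ) (v : FlowerSite m) :
    siteTotal (flowerStep η v) % 2 = (siteTotal η + 1) % 2 := by
  rw [flowerStep, siteTotal_flowerStabilize_mod, siteTotal_add_single]

/-- Arrivals on a petal shift its class by one while topplings preserve all classes, so any classes
can be reached. Particles are lost in pairs, so one more arrival at the center, which affects no
class, corrects the parity if necessary. -/
lemma IsFull.exists_word {η ξ : FlowerSite m → ℕ} (hη : IsFull η) (hξ : IsFull ξ) :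
    ∃ w : List (FlowerSite m), w.foldl Sandpile.flowerStep ξ = η := by
  induction hk : ∑ i, (petalClass (petals η) i - petalClass (petals ξ) i).val
    using Nat.strong_induction_on generalizing ξ with
  | _ k ih =>
    by_cases hcls : petalClass (petals η) = petalClass (petals ξ)
    · by_cases hpar : siteTotal η % 2 = siteTotal ξ % 2
      · exact ⟨[], (hη.eq hξ hcls hpar).symm⟩
      · refine ⟨[center m], ((hη.eq (hξ.flowerStep _) ?_ ?_)).symm⟩
        · rw [petalClass_flowerStep, petalClass_single_center, hcls, add_zero]
        · rw [siteTotal_flowerStep_mod]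
          omega
    · obtain ⟨i, hi⟩ := Function.ne_iff.1 hcls
      suffices h : _ < k by
        obtain ⟨w, hw⟩ := ih _ h (hξ.flowerStep (petalSite (i, false))) rfl
        exact ⟨_ :: w, hw⟩
      rw [← hk, petalClass_flowerStep, petalClass_single_petalSite]
      have hval : ∀ y : ZMod 3, y ≠ 0 → (y - 1).val < y.val := by decide
      refine Finset.sum_lt_sum (fun j _ => ?_) ⟨i, Finset.mem_univ _, ?_⟩
      · by_cases hj : j = i
        · subst hj
          simpa [sub_add_eq_sub_sub] using (hval _ (sub_ne_zero.2 hi)).le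
        · simp [hj]
      · simpa [sub_add_eq_sub_sub] using hval _ (sub_ne_zero.2 hi)

lemma IsFull.foldl {η : FlowerSite m → ℕ} (h : IsFull η) (w : List (FlowerSite m)) :
    IsFull (w.foldl Sandpile.flowerStep η) := by
  induction w generalizing η with
  | nil => exact h
  | cons v w ih => exact ih (h.flowerStep v)

/-- There is a word on which the chain visits a given full configuration, whatever the full
initial configuration in a given finite set. -/
lemma IsFull.exists_universal_word {η : FlowerSite m → ℕ} (hη : IsFull η)
    (F : Finset (FlowerSite m → ℕ)) (hF : ∀ ξ ∈ F, IsFull ξ) :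
    ∃ w : List (FlowerSite m), ∀ ξ ∈ F, ∃ u, u <+: w ∧ u.foldl Sandpile.flowerStep ξ = η := by
  classical
  induction F using Finset.induction_on with
  | empty => exact ⟨[], by simp⟩
  | insert ξ F _ ih =>
    obtain ⟨w, hw⟩ := ih fun ζ hζ => hF ζ (Finset.mem_insert_of_mem hζ)
    obtain ⟨w', hw'⟩ := hη.exists_word ((hF ξ (Finset.mem_insert_self _ _)).foldl w)
    refine ⟨w ++ w', fun ζ hζ => ?_⟩
    obtain rfl | hζ := Finset.mem_insert.1 hζ
    · exact ⟨w ++ w', List.prefix_rfl, by rw [List.foldl_append, hw']⟩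
    · obtain ⟨u, hu, h⟩ := hw ζ hζ
      exact ⟨u, hu.trans (List.prefix_append _ _), h⟩

lemma finite_isFull : {η : FlowerSite m → ℕ | IsFull η}.Finite := by
  refine (Set.Finite.pi' (t := fun v : FlowerSite m => Set.Iio ((flower (m + 1)).degree v.1))
    fun v => Set.finite_Iio _).subset fun η hη => ?_
  exact fun v => hη.1 v

/-- The driven sandpile on the flower graph with a sink petal. -/
noncomputable abbrev flowerChain (ξ : FlowerSite m → ℕ) (s : ℕ → FlowerSite m) (k : ℕ) :
    FlowerSite m → ℕ :=
  drivenChain (flower (m + 1)) (flowerSinks (m + 1)) ξ s k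

lemma flowerChain_succ (ξ : FlowerSite m → ℕ) (s : ℕ → FlowerSite m) (k : ℕ) :
    flowerChain ξ s (k + 1) = flowerStep (flowerChain ξ s k) (s k) := rfl

lemma isStable_flowerChain {ξ : FlowerSite m → ℕ}
    (hξ : IsStable (flower (m + 1)) (flowerSinks (m + 1)) ξ) (s : ℕ → FlowerSite m) (k : ℕ) :
    IsStable (flower (m + 1)) (flowerSinks (m + 1)) (flowerChain ξ s k) := by
  cases k with
  | zero => exact hξ
  | succ k => exact isStable_flowerStabilize _

lemma lossInvariant_flowerChain (ξ : FlowerSite m → ℕ) (s : ℕ → FlowerSite m) (k : ℕ) :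
    LossInvariant (siteTotal ξ + k) (flowerChain ξ s k) := by
  induction k with
  | zero => exact Or.inl rfl
  | succ k ih => exact ih.flowerStep (s k)

lemma IsFull.flowerChain {ξ : FlowerSite m → ℕ} (h : IsFull ξ) (s : ℕ → FlowerSite m) (k : ℕ) :
    IsFull (flowerChain ξ s k) := by
  induction k with
  | zero => exact h
  | succ k ih => exact ih.flowerStep (s k)

lemma isFull_flowerChain {ξ : FlowerSite m → ℕ}
    (hξ : IsStable (flower (m + 1)) (flowerSinks (m + 1)) ξ) (s : ℕ → FlowerSite m) {k : ℕ}
    (hk : 4 * m + 2 ≤ k) : IsFull (flowerChain ξ s k) :=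
  (lossInvariant_flowerChain ξ s k).isFull (isStable_flowerChain hξ s k)
    (hk.trans (Nat.le_add_left _ _))

lemma flowerChain_add_length (ξ : FlowerSite m → ℕ) (s : ℕ → FlowerSite m)
    (w : List (FlowerSite m)) (k : ℕ) (h : ∀ i (hi : i < w.length), s (k + i) = w[i]) :
    flowerChain ξ s (k + w.length) = w.foldl flowerStep (flowerChain ξ s k) := by
  induction w generalizing k with
  | nil => rfl
  | cons v w ih =>
    have h₀ : s k = v := h 0 (by simp)
    rw [List.foldl_cons, ← h₀, ← flowerChain_succ, ← ih (k + 1) fun i hi => ?_]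
    · rw [List.length_cons, add_assoc, add_comm 1]
    · rw [add_assoc, add_comm 1, h (i + 1) (by simpa using hi)]
      rfl

instance : IsProbabilityMeasure (arrivalLaw (flowerSinks (m + 1))) := by
  let _ : MeasurableSpace (FlowerSite m) := ⊤
  rw [arrivalLaw]
  infer_instance

lemma IsFull.isRecurrent {η : FlowerSite m → ℕ} (hη : IsFull η) :
    IsRecurrent (flower (m + 1)) (flowerSinks (m + 1)) η := by
  refine ⟨hη.1, fun ξ hξ => ?_⟩
  obtain ⟨w, hw⟩ := hη.exists_universal_word finite_isFull.toFinset fun ζ hζ => by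
    simpa using hζ
  -- The prefix makes the state full wherever the word occurs. Which full state results is unknown,
  -- hence the universal word after it.
  set w' := List.replicate (4 * m + 2) (center m) ++ w with hw'
  let _ : MeasurableSpace (FlowerSite m) := ⊤
  have hae := ae_exists_word w'.length fun i => w'.getD i (center m)
  rw [arrivalLaw]
  filter_upwards [hae] with s hs
  obtain ⟨k, hk⟩ := hs
  obtain ⟨u, hu, huη⟩ := hw (Sandpile.flowerChain ξ s (k + (4 * m + 2))) <| by
    rw [Set.Finite.mem_toFinset]
    exact isFull_flowerChain hξ s (Nat.le_add_left _ _)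
  refine ⟨k + (4 * m + 2) + u.length, ?_⟩
  rw [← huη]
  refine flowerChain_add_length ξ s u _ fun i hi => ?_
  have hi' : i < w.length := hi.trans_le hu.length_le
  rw [add_assoc, hk _ (by simp [hw', hi']), hu.getElem hi, hw']
  simp [hi']

/-- The full configuration with given petal classes and with `2m + e` particles at the center. -/
noncomputable def fullConfig (a : Bool × (Fin m → ZMod 3)) : FlowerSite m → ℕ := fun v =>
  ((siteEquiv m).symm v).elim (2 * m + a.1.toNat) fun w =>
    if a.2 w.1 = 0 then 1 else if a.2 w.1 = 1 then (!w.2).toNat else w.2.toNat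

lemma fullConfig_center (a : Bool × (Fin m → ZMod 3)) :
    fullConfig a (center m) = 2 * m + a.1.toNat := by
  rw [fullConfig, ← siteEquiv_none, Equiv.symm_apply_apply, Option.elim_none]

lemma petals_fullConfig (a : Bool × (Fin m → ZMod 3)) (w : Fin m × Bool) :
    petals (fullConfig a) w
      = if a.2 w.1 = 0 then 1 else if a.2 w.1 = 1 then (!w.2).toNat else w.2.toNat := by
  rw [petals, fullConfig, ← siteEquiv_some, Equiv.symm_apply_apply, Option.elim_some]

lemma petalClass_fullConfig (a : Bool × (Fin m → ZMod 3)) :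
    petalClass (petals (fullConfig a)) = a.2 := by
  funext i
  simp only [petalClass, petals_fullConfig]
  generalize a.2 i = y
  revert y
  decide

lemma isFull_fullConfig (a : Bool × (Fin m → ZMod 3)) : IsFull (fullConfig a) := by
  have hQ : PetalsNonempty (petals (fullConfig a)) := by
    intro i
    simp only [petals_fullConfig]
    generalize a.2 i = y
    revert y
    decide
  refine ⟨(isStable_flower_iff _).2 ⟨?_, ?_⟩, hQ, ?_⟩
  · rw [fullConfig_center]
    have := a.1.toNat_le
    omega
  · rintro ⟨i, b⟩
    simp only [petals_fullConfig]
    generalize a.2 i = y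
    revert y b
    decide
  · have := le_siteTotal hQ
    rw [fullConfig_center] at this
    omega

lemma siteTotal_fullConfig (a : Bool × (Fin m → ZMod 3)) :
    siteTotal (fullConfig a) = 3 * m + a.1.toNat + balancedOf a.2 := by
  rw [(isFull_fullConfig a).siteTotal_eq, fullConfig_center, balanced, petalClass_fullConfig]
  ring

lemma fullConfig_injective : Function.Injective (fullConfig (m := m)) := by
  intro a b h
  have h₁ := congrFun h (center m)
  rw [fullConfig_center, fullConfig_center, Nat.add_left_cancel_iff] at h₁
  refine Prod.ext (by revert h₁; cases a.1 <;> cases b.1 <;> simp) ?_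
  rw [← petalClass_fullConfig a, h, petalClass_fullConfig]

lemma IsFull.mem_range {η : FlowerSite m → ℕ} (h : IsFull η) : ∃ a, fullConfig a = η := by
  refine ⟨(decide (η (center m) = 2 * m + 1), petalClass (petals η)), ?_⟩
  refine (isFull_fullConfig _).eq h (petalClass_fullConfig _) ?_
  have h₁ := ((isStable_flower_iff η).1 h.1).1
  have h₂ := h.2.2
  have h₃ := h.siteTotal_eq
  rw [siteTotal_fullConfig, h₃, ← balanced]
  by_cases hc : η (center m) = 2 * m + 1 <;> simp [hc] <;> omega

lemma isRecurrent_flower_iff {η : FlowerSite m → ℕ} :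
    IsRecurrent (flower (m + 1)) (flowerSinks (m + 1)) η ↔ IsFull η := by
  refine ⟨fun h => ?_, IsFull.isRecurrent⟩
  -- Full states are closed under the dynamics, so a chain started from one visits nothing else.
  have hfull : IsFull (fullConfig (false, (0 : Fin m → ZMod 3))) := isFull_fullConfig _
  obtain ⟨s, k, hk⟩ := (h.2 _ hfull.1).exists
  rw [← hk]
  exact hfull.flowerChain s k

/-! ### The stationary density -/

/-- Shifting one coordinate permutes the class vectors, so each of the three values of that
coordinate is taken equally often. -/
lemma three_mul_sum_balancedOf :
    3 * ∑ x : Fin m → ZMod 3, balancedOf x = m * 3 ^ m := by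
  have h : ∀ i : Fin m, 3 * ∑ x : Fin m → ZMod 3, (if x i = 0 then 1 else 0) = 3 ^ m := by
    intro i
    have hrot : ∀ y : ZMod 3, ∑ x : Fin m → ZMod 3, (if x i + y = 0 then 1 else 0)
        = ∑ x : Fin m → ZMod 3, if x i = 0 then 1 else 0 := by
      intro y
      refine Eq.trans ?_ (Equiv.sum_comp (Equiv.addRight (Pi.single i y)) fun x : Fin m → ZMod 3 =>
        if x i = 0 then 1 else 0)
      exact Finset.sum_congr rfl fun x _ => by simp
    have hone : ∀ y : ZMod 3, ((if y + 0 = 0 then 1 else 0) + if y + 1 = 0 then 1 else 0)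
        + (if y + 2 = 0 then 1 else 0) = 1 := by decide
    calc 3 * ∑ x : Fin m → ZMod 3, (if x i = 0 then 1 else 0)
        = ∑ x : Fin m → ZMod 3, (((if x i + 0 = 0 then 1 else 0)
            + if x i + 1 = 0 then 1 else 0) + if x i + 2 = 0 then 1 else 0) := by
          rw [Finset.sum_add_distrib, Finset.sum_add_distrib, hrot, hrot, hrot]
          ring
      _ = 3 ^ m := by simp only [hone]; simp
  simp only [balancedOf]
  rw [Finset.sum_comm, Finset.mul_sum]
  simp only [h]
  simp

lemma integral_uniformOn {Ω : Type*} [MeasurableSpace Ω] [MeasurableSingletonClass Ω]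
    (s : Finset Ω) (f : Ω → ℝ) :
    ∫ x, f x ∂(uniformOn (s : Set Ω)) = (∑ x ∈ s, f x) / s.card := by
  rw [uniformOn, ProbabilityTheory.cond, integral_smul_measure, Measure.count_apply_finset, setIntegral_finset]
  · simp [Measure.real, div_eq_inv_mul]
  · rw [← Set.biUnion_of_singleton (s : Set Ω)]
    exact integrableOn_finset_iUnion.2 fun x _ => integrableOn_singleton
      (hx := by simp)

/-- The mean total is `3m + 1/2 + m/3`: the constant part, the fair bit at the center, and the mean
number of balanced petals. -/
lemma stationaryDensity_flower (m : ℕ) :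
    stationaryDensity (flower (m + 1)) (flowerSinks (m + 1))
      = (10 / 3 * m + 1 / 2) / (2 * m + 1) := by
  classical
  have hset : {η : FlowerSite m → ℕ | IsRecurrent (flower (m + 1)) (flowerSinks (m + 1)) η}
      = (Finset.univ.image (fullConfig (m := m)) : Set (FlowerSite m → ℕ)) := by
    ext η
    simp only [Set.mem_ofPred_eq, isRecurrent_flower_iff, Finset.coe_image, Finset.coe_univ,
      Set.image_univ, Set.mem_range]
    exact ⟨IsFull.mem_range, fun ⟨a, ha⟩ => ha ▸ isFull_fullConfig a⟩
  rw [stationaryDensity, hset, integral_uniformOn,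
    Finset.sum_image fun _ _ _ _ h => fullConfig_injective h,
    Finset.card_image_of_injective _ fullConfig_injective]
  have h := congrArg (Nat.cast : ℕ → ℝ) (three_mul_sum_balancedOf (m := m))
  simp only [density_eq, siteTotal_fullConfig, ← Finset.sum_div, Fintype.sum_prod_type,
    Fintype.sum_bool]
  push_cast at h ⊢
  simp only [Finset.sum_add_distrib, Finset.sum_const, Finset.card_univ, Fintype.card_prod,
    Fintype.card_bool, Fintype.card_pi, ZMod.card, Finset.prod_const, Fintype.card_fin,
    nsmul_eq_mul, Bool.toNat_true, Bool.toNat_false]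
  push_cast
  have h3 : (3 : ℝ) ^ m ≠ 0 := by positivity
  have h2 : (2 * m + 1 : ℝ) ≠ 0 := by positivity
  field_simp
  linear_combination 2 * h

theorem tendsto_stationaryDensity :
    Tendsto (fun n => stationaryDensity (flower n) (flowerSinks n)) atTop (𝓝 (5 / 3)) := by
  rw [← tendsto_add_atTop_iff_nat 1]
  simp only [stationaryDensity_flower]
  have h : Tendsto (fun m : ℕ => (10 / 3 + 1 / 2 * (m : ℝ)⁻¹) / (2 + (m : ℝ)⁻¹)) atTop
      (𝓝 ((10 / 3 + 1 / 2 * 0) / (2 + 0))) :=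
    ((tendsto_inv_atTop_nhds_zero_nat.const_mul _).const_add _).div
      (tendsto_inv_atTop_nhds_zero_nat.const_add _) (by norm_num)
  norm_num at h
  refine h.congr' ?_
  filter_upwards [eventually_gt_atTop 0] with m hm
  have : (m : ℝ) ≠ 0 := by positivity
  field_simp

end Recurrent

/-! ### Poisson variables -/

lemma hasSum_exp_mul_poisson (r : ℝ≥0) (t : ℝ) :
    HasSum (fun k : ℕ => Real.exp (-r) * r ^ k / k.factorial * Real.exp (t * k))
      (Real.exp (r * (Real.exp t - 1))) := by
  have h := (NormedSpace.expSeries_div_hasSum_exp (r * Real.exp t : ℝ)).mul_left (Real.exp (-r))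
  rw [← Real.exp_eq_exp_ℝ, ← Real.exp_add] at h
  convert! h using 1
  · funext k
    rw [mul_pow, ← Real.exp_nat_mul, mul_comm t]
    ring
  · congr 1
    ring

lemma integrable_exp_mul_poisson (r : ℝ≥0) (t : ℝ) :
    Integrable (fun k : ℕ => Real.exp (t * k)) (poissonMeasure r) := by
  rw [integrable_poissonMeasure_iff]
  simpa only [Real.norm_eq_abs, Real.abs_exp] using (hasSum_exp_mul_poisson r t).summable

lemma mgf_poisson (r : ℝ≥0) (t : ℝ) :
    mgf (fun k : ℕ => (k : ℝ)) (poissonMeasure r) t = Real.exp (r * (Real.exp t - 1)) := by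
  rw [mgf, integral_poissonMeasure]
  exact (hasSum_exp_mul_poisson r t).tsum_eq

lemma mem_interior_integrableExpSet_poisson (r : ℝ≥0) :
    (0 : ℝ) ∈ interior (integrableExpSet (fun k : ℕ => (k : ℝ)) (poissonMeasure r)) := by
  have : integrableExpSet (fun k : ℕ => (k : ℝ)) (poissonMeasure r) = Set.univ :=
    Set.eq_univ_of_forall fun t => integrable_exp_mul_poisson r t
  simp [this]

lemma memLp_two_poisson (r : ℝ≥0) : MemLp (fun k : ℕ => (k : ℝ)) 2 (poissonMeasure r) := by
  simpa using memLp_of_mem_interior_integrableExpSet (mem_interior_integrableExpSet_poisson r) 2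

lemma integral_id_poisson (r : ℝ≥0) : ∫ k, (k : ℝ) ∂(poissonMeasure r) = r := by
  have h := deriv_mgf_zero (mem_interior_integrableExpSet_poisson r)
  rw [← h, funext (mgf_poisson r)]
  have hd : HasDerivAt (fun t : ℝ => Real.exp (r * (Real.exp t - 1)))
      (Real.exp (r * (Real.exp 0 - 1)) * (r * Real.exp 0)) 0 :=
    (((Real.hasDerivAt_exp 0).sub_const 1).const_mul (r : ℝ)).exp
  simpa using hd.deriv

/-- The probability that the difference of two independent Poisson variables of parameter `r` is
divisible by `3`. -/
noncomputable def balancedProb (r : ℝ) : ℝ := (1 + 2 * Real.exp (-3 * r)) / 3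

lemma cos_two_pi_div_three : Real.cos (2 * Real.pi / 3) = -(1 / 2) := by
  rw [show 2 * Real.pi / 3 = Real.pi - Real.pi / 3 by ring, Real.cos_pi_sub, Real.cos_pi_div_three]

/-- Fourier expansion of the indicator on the group of order 3. The cosine of the difference is
expanded into products so that independence can be used. -/
lemma ite_mod_three_eq (a b : ℕ) :
    (if a % 3 = b % 3 then 1 else 0 : ℝ)
      = (1 + 2 * (Real.cos (2 * Real.pi / 3 * a) * Real.cos (2 * Real.pi / 3 * b)
          + Real.sin (2 * Real.pi / 3 * a) * Real.sin (2 * Real.pi / 3 * b))) / 3 := by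
  have hcos : Real.cos (2 * Real.pi / 3 * 2) = -(1 / 2) := by
    rw [mul_comm, Real.cos_two_mul, cos_two_pi_div_three]
    norm_num
  have hk : ∀ k : ℕ, (k : ℝ) = (k % 3 : ℕ) + 3 * (k / 3 : ℕ) := fun k => by
    exact_mod_cast (Nat.mod_add_div k 3).symm
  have hred : 2 * Real.pi / 3 * a - 2 * Real.pi / 3 * b
      = 2 * Real.pi / 3 * ((a % 3 : ℕ) - (b % 3 : ℕ))
        + ((a / 3 : ℕ) - (b / 3 : ℕ) : ℤ) * (2 * Real.pi) := by
    rw [hk a, hk b, Int.cast_sub, Int.cast_natCast, Int.cast_natCast]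
    ring
  rw [← Real.cos_sub, hred, Real.cos_add_int_mul_two_pi]
  have ha : a % 3 < 3 := Nat.mod_lt _ (by norm_num)
  have hb : b % 3 < 3 := Nat.mod_lt _ (by norm_num)
  generalize a % 3 = x at ha ⊢
  generalize b % 3 = y at hb ⊢
  interval_cases x <;> interval_cases y <;>
    norm_num [mul_neg, Real.cos_neg, cos_two_pi_div_three, hcos]

/-- The left side is the squared modulus of the characteristic function `exp(r(exp(it) - 1))`. -/
lemma integral_cos_sq_add_sin_sq_poisson (r : ℝ≥0) (t : ℝ) :
    (∫ k : ℕ, Real.cos (t * k) ∂(poissonMeasure r)) ^ 2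
      + (∫ k : ℕ, Real.sin (t * k) ∂(poissonMeasure r)) ^ 2
      = Real.exp (2 * (r * (Real.cos t - 1))) := by
  have hexp : ∀ k : ℕ, Complex.exp (t * k * Complex.I)
      = ⟨Real.cos (t * k), Real.sin (t * k)⟩ := by
    intro k
    rw [← Complex.ofReal_natCast, ← Complex.ofReal_mul]
    exact Complex.ext (Complex.exp_ofReal_mul_I_re _) (Complex.exp_ofReal_mul_I_im _)
  have hint : Integrable (fun k : ℕ => Complex.exp (t * k * Complex.I)) (poissonMeasure r) := by
    refine Integrable.of_bound (C := 1) (by fun_prop) (.of_forall fun k => ?_)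
    rw [← Complex.ofReal_natCast, ← Complex.ofReal_mul, Complex.norm_exp_ofReal_mul_I]
  have h := charFun_map_cast_poissonMeasure r t
  rw [charFun_apply_real, integral_map .of_discrete (by fun_prop)] at h
  have hre := integral_re hint
  have him := integral_im hint
  simp only [Complex.ofReal_natCast] at h
  rw [h] at hre him
  simp only [hexp] at hre him
  simp only [RCLike.re_to_complex, RCLike.im_to_complex] at hre him
  rw [hre, him]
  have := Complex.normSq_apply (Complex.exp (r * (Complex.exp (t * Complex.I) - 1)))
  rw [Complex.normSq_eq_norm_sq, Complex.norm_exp, ← Real.exp_nat_mul] at this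
  rw [sq, sq, ← this]
  simp [Complex.exp_ofReal_mul_I_re]

/-- The probability that two independent Poisson variables are congruent modulo `3`. -/
lemma integral_ite_mod_three (r : ℝ≥0) :
    ∫ z : ℕ × ℕ, (if z.1 % 3 = z.2 % 3 then 1 else 0 : ℝ)
      ∂((poissonMeasure r).prod (poissonMeasure r)) = balancedProb r := by
  have hb : ∀ f g : ℕ → ℝ, (∀ k, |f k| ≤ 1) → (∀ k, |g k| ≤ 1) →
      Integrable (fun z : ℕ × ℕ => f z.1 * g z.2)
        ((poissonMeasure r).prod (poissonMeasure r)) := fun f g hf hg =>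
    Integrable.of_bound (C := 1) .of_discrete <| .of_forall fun z => by
      rw [Real.norm_eq_abs, abs_mul]
      exact mul_le_one₀ (hf _) (abs_nonneg _) (hg _)
  have hc := hb _ _ (fun k => Real.abs_cos_le_one (2 * Real.pi / 3 * k))
    (fun k => Real.abs_cos_le_one (2 * Real.pi / 3 * k))
  have hs := hb _ _ (fun k => Real.abs_sin_le_one (2 * Real.pi / 3 * k))
    (fun k => Real.abs_sin_le_one (2 * Real.pi / 3 * k))
  have hcs : Integrable (fun z : ℕ × ℕ => 2 *
      (Real.cos (2 * Real.pi / 3 * z.1) * Real.cos (2 * Real.pi / 3 * z.2)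
        + Real.sin (2 * Real.pi / 3 * z.1) * Real.sin (2 * Real.pi / 3 * z.2)))
      ((poissonMeasure r).prod (poissonMeasure r)) := (hc.add hs).const_mul 2
  simp only [ite_mod_three_eq]
  rw [integral_div, integral_add (integrable_const _) hcs,
    integral_const_mul, integral_add hc hs,
    integral_prod_mul (fun k : ℕ => Real.cos (2 * Real.pi / 3 * k))
      (fun k : ℕ => Real.cos (2 * Real.pi / 3 * k)),
    integral_prod_mul (fun k : ℕ => Real.sin (2 * Real.pi / 3 * k))
      (fun k : ℕ => Real.sin (2 * Real.pi / 3 * k)), ← sq, ← sq,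
    integral_cos_sq_add_sin_sq_poisson, cos_two_pi_div_three, balancedProb]
  simp only [integral_const, probReal_univ, one_smul]
  ring_nf

/-! ### Independent Poisson heights -/

section Heights

/-- The functions `U v` are independent Poisson variables of parameter `r`. -/
structure IsPoissonHeights {V Ω : Type*} [MeasurableSpace Ω] (P : Measure Ω) (r : ℝ≥0)
    (U : V → Ω → ℕ) : Prop where
  measurable : ∀ v, Measurable (U v)
  indep : iIndepFun U P
  law : ∀ v, P.map (U v) = poissonMeasure r

variable {Ω : Type*} [MeasurableSpace Ω] {P : Measure Ω} [IsProbabilityMeasure P] {r : ℝ≥0}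

lemma IsPoissonHeights.map_pair {V : Type*} {U : V → Ω → ℕ} (hU : IsPoissonHeights P r U)
    {v w : V} (h : v ≠ w) :
    P.map (fun ω => (U v ω, U w ω)) = (poissonMeasure r).prod (poissonMeasure r) := by
  rw [(indepFun_iff_map_prod_eq_prod_map_map (hU.measurable v).aemeasurable
    (hU.measurable w).aemeasurable).1 (hU.indep.indepFun h), hU.law, hU.law]

/-- Chebyshev's inequality for a sum over the petals of a function of the two heights. -/
lemma IsPoissonHeights.chebyshev {n : ℕ} {U : Option (Fin n × Bool) → Ω → ℕ}
    (hU : IsPoissonHeights P r U) {h : ℕ × ℕ → ℝ}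
    (hh : MemLp h 2 ((poissonMeasure r).prod (poissonMeasure r))) {ε : ℝ} (hε : 0 < ε)
    (hn : 0 < n) :
    P {ω | ε * n ≤ |∑ i, h (U (some (i, false)) ω, U (some (i, true)) ω)
        - (∫ z, h z ∂((poissonMeasure r).prod (poissonMeasure r))) * n|}
      ≤ ENNReal.ofReal (Var[h; (poissonMeasure r).prod (poissonMeasure r)] / ε ^ 2 * (n : ℝ)⁻¹) := by
  set ν := (poissonMeasure r).prod (poissonMeasure r)
  let X : Fin n → Ω → ℕ × ℕ := fun i ω => (U (some (i, false)) ω, U (some (i, true)) ω)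
  have hX : ∀ i, MeasurePreserving (X i) P ν := fun i =>
    ⟨(hU.measurable _).prodMk (hU.measurable _), hU.map_pair (by simp)⟩
  have hY : ∀ i, MemLp (h ∘ X i) 2 P := fun i => hh.comp_measurePreserving (hX i)
  have hvar : Var[∑ i, h ∘ X i; P] = n * Var[h; ν] := by
    rw [IndepFun.variance_sum fun i _ => hY i]
    · have : ∀ i, Var[h ∘ X i; P] = Var[h; ν] := fun i => (hX i).variance_fun_comp .of_discrete
      simp [this]
    · intro i _ j _ hij
      exact (hU.indep.indepFun_prodMk_prodMk hU.measurable _ _ _ _ (by simp [hij]) (by simp [hij])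
        (by simp [hij]) (by simp [hij])).comp .of_discrete .of_discrete
  have hmean : P[∑ i, h ∘ X i] = (∫ z, h z ∂ν) * n := by
    simp only [Finset.sum_apply]
    rw [integral_finsetSum _ fun i _ => (hY i).integrable one_le_two]
    have : ∀ i, ∫ ω, (h ∘ X i) ω ∂P = ∫ z, h z ∂ν := fun i => by
      rw [← (hX i).map_eq, integral_map (hX i).aemeasurable .of_discrete]
      rfl
    rw [Finset.sum_congr rfl fun i _ => this i]
    simp [mul_comm]
  have hn' : (0 : ℝ) < n := by positivity
  have key := meas_ge_le_variance_div_sq (memLp_finsetSum' Finset.univ fun i _ => hY i)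
    (mul_pos hε hn')
  rw [hvar, hmean] at key
  simp only [Finset.sum_apply] at key
  refine key.trans_eq ?_
  congr 1
  field_simp

end Heights

/-! ### Laws of large numbers for balanced petals and for the particle total -/

section Limits

variable {Ω : ℕ → Type*} [∀ n, MeasurableSpace (Ω n)] {P : ∀ n, Measure (Ω n)}
  [∀ n, IsProbabilityMeasure (P n)] {r : ℝ≥0} {U : ∀ n, Option (Fin n × Bool) → Ω n → ℕ}

lemma tendsto_ofReal_mul_inv (c : ℝ) :
    Tendsto (fun n : ℕ => ENNReal.ofReal (c * (n : ℝ)⁻¹)) atTop (𝓝 0) := by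
  have h := ENNReal.tendsto_ofReal (tendsto_inv_atTop_nhds_zero_nat (𝕜 := ℝ).const_mul c)
  simpa using h

lemma tendsto_measure_sum_petals (hU : ∀ n, IsPoissonHeights (P n) r (U n)) {h : ℕ × ℕ → ℝ}
    (hh : MemLp h 2 ((poissonMeasure r).prod (poissonMeasure r))) {ε : ℝ} (hε : 0 < ε) :
    Tendsto (fun n => P n {ω | ε * n ≤ |∑ i, h (U n (some (i, false)) ω, U n (some (i, true)) ω)
        - (∫ z, h z ∂((poissonMeasure r).prod (poissonMeasure r))) * n|}) atTop (𝓝 0) := by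
  refine tendsto_of_tendsto_of_tendsto_of_le_of_le' tendsto_const_nhds
    (tendsto_ofReal_mul_inv (Var[h; (poissonMeasure r).prod (poissonMeasure r)] / ε ^ 2)) (.of_forall fun _ => zero_le) ?_
  filter_upwards [eventually_gt_atTop 0] with n hn
  exact (hU n).chebyshev hh hε hn

/-- The number of balanced petals obeys the law of large numbers. -/
lemma tendsto_measure_balanced (hU : ∀ n, IsPoissonHeights (P n) r (U n)) {ε : ℝ} (hε : 0 < ε) :
    Tendsto (fun n => P n {ω | ε * n ≤
      |((balanced fun v => U n (some v) ω : ℕ) : ℝ) - balancedProb r * n|}) atTop (𝓝 0) := by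
  have h := tendsto_measure_sum_petals hU (h := fun z => if z.1 % 3 = z.2 % 3 then 1 else 0)
    (MemLp.of_bound .of_discrete 1 <| .of_forall fun z => by split_ifs <;> simp) hε
  rw [integral_ite_mod_three] at h
  simpa only [balanced_eq, Nat.cast_sum, Nat.cast_ite, Nat.cast_one, Nat.cast_zero] using h

omit [∀ n, IsProbabilityMeasure (P n)] in
lemma tendsto_measure_center (hU : ∀ n, IsPoissonHeights (P n) r (U n)) {ε : ℝ} (hε : 0 < ε) :
    Tendsto (fun n => P n {ω | ε * n ≤ (U n none ω : ℝ)}) atTop (𝓝 0) := by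
  refine tendsto_of_tendsto_of_tendsto_of_le_of_le' tendsto_const_nhds
    (tendsto_ofReal_mul_inv (r / ε)) (.of_forall fun _ => zero_le) ?_
  filter_upwards [eventually_gt_atTop 0] with n hn
  have hn' : (0 : ℝ) < n := by positivity
  have hmap : P n {ω | ε * n ≤ (U n none ω : ℝ)} = poissonMeasure r {k | ε * n ≤ (k : ℝ)} := by
    rw [← (hU n).law none, Measure.map_apply ((hU n).measurable _) .of_discrete]
    rfl
  have hmarkov := mul_meas_ge_le_integral_of_nonneg (μ := poissonMeasure r)
    (f := fun k : ℕ => (k : ℝ)) (.of_forall fun k => Nat.cast_nonneg k)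
    ((memLp_two_poisson r).integrable one_le_two) (ε * n)
  rw [integral_id_poisson] at hmarkov
  rw [hmap, ← ofReal_measureReal]
  refine ENNReal.ofReal_le_ofReal ?_
  rw [div_mul_eq_mul_div, le_div_iff₀ hε, ← div_eq_mul_inv, le_div_iff₀ hn']
  linarith

lemma integral_add_poisson (r : ℝ≥0) :
    ∫ z : ℕ × ℕ, (z.1 + z.2 : ℝ) ∂((poissonMeasure r).prod (poissonMeasure r)) = 2 * r := by
  have hi := (memLp_two_poisson r).integrable one_le_two
  rw [integral_add (hi.comp_fst _) (hi.comp_snd _), integral_fun_fst (fun k : ℕ => (k : ℝ)),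
    integral_fun_snd (fun k : ℕ => (k : ℝ)), integral_id_poisson]
  simp [two_mul]

lemma memLp_add_poisson (r : ℝ≥0) :
    MemLp (fun z : ℕ × ℕ => (z.1 + z.2 : ℝ)) 2
      ((poissonMeasure r).prod (poissonMeasure r)) :=
  ((memLp_two_poisson r).comp_fst _).add ((memLp_two_poisson r).comp_snd _)

/-- The number of particles obeys the law of large numbers. -/
lemma tendsto_measure_total (hU : ∀ n, IsPoissonHeights (P n) r (U n)) {ε : ℝ} (hε : 0 < ε) :
    Tendsto (fun n => P n {ω | ε * n ≤
      |((U n none ω + petalTotal fun v => U n (some v) ω : ℕ) : ℝ) - 2 * r * n|})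
      atTop (𝓝 0) := by
  have h₁ := tendsto_measure_sum_petals hU (memLp_add_poisson r) (half_pos hε)
  have h₂ := tendsto_measure_center hU (half_pos hε)
  rw [integral_add_poisson] at h₁
  have h := h₁.add h₂
  rw [add_zero] at h
  refine tendsto_of_tendsto_of_tendsto_of_le_of_le tendsto_const_nhds h (fun _ => zero_le)
    fun n => (measure_mono fun ω hω => ?_).trans (measure_union_le _ _)
  simp only [Set.mem_ofPred_eq, Set.mem_union, petalTotal] at hω ⊢
  push_cast at hω
  by_contra! hcon
  have hc : (0 : ℝ) ≤ U n none ω := Nat.cast_nonneg _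
  rw [abs_lt] at hcon
  refine absurd hω (not_le.2 (abs_lt.2 ⟨?_, ?_⟩)) <;> linarith [hcon.1.1, hcon.1.2, hcon.2]

end Limits

/-! ### The critical density -/

/-- The limit of the final density at supercritical initial density `z`. -/
noncomputable def densityCurve (z : ℝ) : ℝ := 5 / 3 + 1 / 3 * Real.exp (-3 * z)

/-- Per petal, the capacity `3 + balancedProb z` is compared with `2z` particles, so criticality
means `z = densityCurve z`. -/
lemma three_add_balancedProb (z : ℝ) : 3 + balancedProb z = 2 * densityCurve z := by
  rw [balancedProb, densityCurve]
  ring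

lemma strictMono_sub_densityCurve : StrictMono fun z => z - densityCurve z := by
  intro x y h
  have : Real.exp (-3 * y) < Real.exp (-3 * x) := Real.exp_lt_exp.2 (by linarith)
  simp only [densityCurve]
  linarith

lemma exists_densityCurve_eq : ∃ z, 0 < z ∧ densityCurve z = z := by
  have hcont : ContinuousOn (fun z => z - densityCurve z) (Set.Icc 0 2) := by
    unfold densityCurve
    fun_prop
  have h2 : Real.exp (-6) ≤ 1 := Real.exp_le_one_iff.2 (by norm_num)
  obtain ⟨z, hz, h⟩ := intermediate_value_Icc (by norm_num : (0 : ℝ) ≤ 2) hcont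
    (show (0 : ℝ) ∈ Set.Icc _ _ by
      constructor <;> simp only [densityCurve] <;> norm_num
      linarith)
  have h : z = densityCurve z := sub_eq_zero.1 h
  refine ⟨z, ?_, h.symm⟩
  rw [h, densityCurve]
  positivity

/-! ### The final density -/

lemma isPoissonHeights_poissonConfig (m : ℕ) (r : ℝ≥0) :
    IsPoissonHeights (poissonConfig (flowerSinks (m + 1)) r) r
      fun (o : Option (Fin m × Bool)) (σ : FlowerSite m → ℕ) => σ (siteEquiv m o) where
  measurable _ := measurable_pi_apply _
  indep := (iIndepFun_pi (X := fun _ : FlowerSite m => (id : ℕ → ℕ)) (μ := fun _ => poissonMeasure r)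
    fun _ => aemeasurable_id).precomp (siteEquiv m).injective
  law _ := (measurePreserving_eval (fun _ : FlowerSite m => poissonMeasure r) _).map_eq

instance {n : ℕ} (S : Finset (FlowerVertex n)) (r : ℝ≥0) : IsProbabilityMeasure (poissonConfig S r) := by
  unfold poissonConfig
  infer_instance

lemma abs_min_sub_min_lt {a b c d δ : ℝ} (h₁ : |a - c| < δ) (h₂ : |b - d| < δ) :
    |min a b - min c d| < δ :=
  (abs_min_sub_min_le_max a b c d).trans_lt (max_lt h₁ h₂)

/-- The numerator is within `εm + 2` of `2m` times the limit, and the denominator `2m + 1` costs one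
more copy of the limit. Both bounded errors are absorbed by the spare `εm`, which `hm` makes large
enough. -/
lemma abs_finalDensity_sub_lt {m : ℕ} {x ε : ℝ} (hx : 0 ≤ x) (σ : FlowerSite m → ℕ)
    (hm : (8 + 2 * densityCurve x) < 2 * ε * m)
    (h₁ : |(siteTotal σ : ℝ) - 2 * x * m| < ε * m)
    (h₂ : |(balanced (petals σ) : ℝ) - balancedProb x * m| < ε * m) :
    |finalDensity (flower (m + 1)) (flowerSinks (m + 1)) σ - min x (densityCurve x)| < ε := by
  obtain ⟨hle, hge⟩ := siteTotal_flowerStabilize σ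
  rw [← @Nat.cast_le ℝ] at hle hge
  push_cast at hle hge
  have h₃ : |(3 * m + balanced (petals σ) : ℝ) - 2 * densityCurve x * m| < ε * m := by
    rw [← three_add_balancedProb]
    convert! h₂ using 2
    ring
  have h₄ := abs_lt.1 (abs_min_sub_min_lt h₁ h₃)
  have hmin : min (2 * x * m) (2 * densityCurve x * m) = 2 * m * min x (densityCurve x) := by
    rw [mul_min_of_nonneg _ _ (by positivity)]
    congr 1 <;> ring
  have hM₀ : 0 ≤ min x (densityCurve x) := le_min hx (by unfold densityCurve; positivity)
  have hM₁ : min x (densityCurve x) ≤ densityCurve x := min_le_right _ _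
  rw [hmin] at h₄
  have hpos : (0 : ℝ) < 2 * m + 1 := by positivity
  have hε : 0 < ε := by
    by_contra! h
    have : 2 * ε * m ≤ 0 := mul_nonpos_of_nonpos_of_nonneg (by linarith) (Nat.cast_nonneg m)
    linarith
  rw [finalDensity, density_eq, div_sub' hpos.ne', abs_div, abs_of_pos hpos, div_lt_iff₀ hpos,
    abs_lt]
  constructor <;> linarith [h₄.1, h₄.2]

theorem tendsto_finalDensity (r : ℝ≥0) {ε : ℝ} (hε : 0 < ε) :
    Tendsto (fun n => poissonConfig (flowerSinks n) r
      {σ | ε ≤ |finalDensity (flower n) (flowerSinks n) σ - min (r : ℝ) (densityCurve r)|})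
      atTop (𝓝 0) := by
  rw [← tendsto_add_atTop_iff_nat 1]
  have h₁ := tendsto_measure_total (fun m => isPoissonHeights_poissonConfig m r) hε
  have h₂ := tendsto_measure_balanced (fun m => isPoissonHeights_poissonConfig m r) hε
  have h := h₁.add h₂
  rw [add_zero] at h
  have hlarge : ∀ᶠ m : ℕ in atTop, 8 + 2 * densityCurve r < 2 * ε * m :=
    (tendsto_natCast_atTop_atTop.const_mul_atTop (by positivity : 0 < 2 * ε)).eventually_gt_atTop _
  refine tendsto_of_tendsto_of_tendsto_of_le_of_le' tendsto_const_nhds h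
    (.of_forall fun _ => zero_le) ?_
  filter_upwards [hlarge] with m hm
  refine (measure_mono fun σ hσ => ?_).trans (measure_union_le _ _)
  simp only [Set.mem_ofPred_eq, Set.mem_union] at hσ ⊢
  by_contra! hcon
  refine absurd hσ (not_le.2 (abs_finalDensity_sub_lt r.2 σ hm ?_ hcon.2))
  rw [siteTotal_eq]
  exact hcon.1

/-! ### The threshold density -/

section Threshold

/-- The supremum of the times at which a decreasing family of events holds. -/
noncomputable def lastTime {Ω : Type*} (A : ℝ≥0 → Set Ω) (ω : Ω) : ℝ≥0∞ :=
  ⨆ (t : ℝ≥0) (_ : ω ∈ A t), (t : ℝ≥0∞)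

variable {Ω : Type*} [MeasurableSpace Ω] {P : Measure Ω} {A : ℝ≥0 → Set Ω}

omit [MeasurableSpace Ω] in
lemma mem_of_lt_lastTime {ω : Ω} (hω : Antitone fun t => ω ∈ A t) {t : ℝ≥0}
    (h : (t : ℝ≥0∞) < lastTime A ω) : ω ∈ A t := by
  simp only [lastTime, lt_iSup_iff] at h
  obtain ⟨s, hs, hts⟩ := h
  exact hω (ENNReal.coe_lt_coe.1 hts).le hs

omit [MeasurableSpace Ω] in
lemma le_lastTime {ω : Ω} {t : ℝ≥0} (h : ω ∈ A t) : (t : ℝ≥0∞) ≤ lastTime A ω :=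
  le_iSup₂ (f := fun (t : ℝ≥0) (_ : ω ∈ A t) => (t : ℝ≥0∞)) t h

lemma aemeasurable_lastTime (hA : ∀ t, MeasurableSet (A t))
    (hanti : ∀ᵐ ω ∂P, Antitone fun t => ω ∈ A t) : AEMeasurable (lastTime A) P := by
  -- For decreasing events the supremum can be taken over countably many times. Negative rationals
  -- are sent to time 0, which is harmless.
  refine ⟨fun ω => ⨆ q : ℚ, (A (Real.toNNReal q)).indicator
    (fun _ => (Real.toNNReal q : ℝ≥0∞)) ω,
    Measurable.iSup fun q => measurable_const.indicator (hA _), ?_⟩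
  filter_upwards [hanti] with ω hω
  refine le_antisymm (le_of_forall_lt fun c hc => ?_) (iSup_le fun q => ?_)
  · obtain ⟨q, -, hcq, hq⟩ := ENNReal.lt_iff_exists_rat_btwn.1 hc
    refine hcq.trans_le (le_iSup_of_le q ?_)
    rw [Set.indicator_of_mem (mem_of_lt_lastTime hω hq)]
  · by_cases h : ω ∈ A (Real.toNNReal q)
    · rw [Set.indicator_of_mem h]
      exact le_lastTime h
    · rw [Set.indicator_of_notMem h]
      exact zero_le

lemma ae_lastTime_ne_top (hanti : ∀ᵐ ω ∂P, Antitone fun t => ω ∈ A t)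
    (h : Tendsto (fun k : ℕ => P (A k)) atTop (𝓝 0)) : ∀ᵐ ω ∂P, lastTime A ω ≠ ∞ := by
  rw [ae_iff]
  refine le_antisymm (ge_of_tendsto' h fun k => measure_mono_ae ?_) zero_le
  filter_upwards [hanti] with ω hω htop
  have htop : lastTime A ω = ∞ := not_not.1 htop
  exact mem_of_lt_lastTime hω (by rw [htop]; exact ENNReal.coe_lt_top)

lemma lintegral_lastTime (hA : ∀ t, MeasurableSet (A t))
    (hanti : ∀ᵐ ω ∂P, Antitone fun t => ω ∈ A t) (htop : ∀ᵐ ω ∂P, lastTime A ω ≠ ∞) :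
    ∫⁻ ω, lastTime A ω ∂P = ∫⁻ t in Set.Ioi (0 : ℝ), P {ω | t < (lastTime A ω).toReal} := by
  rw [← lintegral_eq_lintegral_meas_lt P (.of_forall fun ω => ENNReal.toReal_nonneg)
    (aemeasurable_lastTime hA hanti).ennreal_toReal]
  refine lintegral_congr_ae ?_
  filter_upwards [htop] with ω hω
  rw [ENNReal.ofReal_toReal hω]

lemma measure_lt_lastTime_le (hanti : ∀ᵐ ω ∂P, Antitone fun t => ω ∈ A t) (t : ℝ≥0) :
    P {ω | (t : ℝ) < (lastTime A ω).toReal} ≤ P (A t) := by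
  refine measure_mono_ae ?_
  filter_upwards [hanti] with ω hω h
  refine mem_of_lt_lastTime hω ?_
  have htop : lastTime A ω ≠ ∞ := fun h' => by
    have h : (t : ℝ) < (lastTime A ω).toReal := h
    rw [h', ENNReal.toReal_top] at h
    exact absurd h (not_lt.2 t.2)
  rw [← ENNReal.toReal_lt_toReal ENNReal.coe_ne_top htop]
  exact h

/-- A strictly later time `s` is used because membership at `t` alone gives only `t ≤ lastTime A ω`.
-/
lemma le_measure_lt_lastTime (htop : ∀ᵐ ω ∂P, lastTime A ω ≠ ∞) {t : ℝ} {s : ℝ≥0} (hts : t < s) :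
    P (A s) ≤ P {ω | t < (lastTime A ω).toReal} := by
  refine measure_mono_ae ?_
  filter_upwards [htop] with ω hω h
  exact hts.trans_le (ENNReal.toReal_mono hω (le_lastTime h))

end Threshold

/-! ### Convergence of the expected threshold on the flower graph -/

section ThresholdDensity

lemma IsUnitPoissonProcess.map_eq {Ω : Type*} [MeasurableSpace Ω] {P : Measure Ω}
    {N : ℝ≥0 → Ω → ℕ} (h : IsUnitPoissonProcess P N) (t : ℝ≥0) :
    P.map (N t) = poissonMeasure t := by
  have := h.law_increments 0 t zero_le
  rw [tsub_zero] at this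
  rw [← this]
  refine Measure.map_congr ?_
  filter_upwards [h.zero] with ω hω
  rw [hω, Nat.sub_zero]

lemma IsPoissonFamily.isPoissonHeights {V Ω : Type*} [MeasurableSpace Ω] {P : Measure Ω}
    {N : V → ℝ≥0 → Ω → ℕ} (h : IsPoissonFamily P N) (t : ℝ≥0) :
    IsPoissonHeights P t fun v => N v t where
  measurable v := (h.process v).measurable t
  indep := h.indep.comp (fun _ f => f t) fun _ => measurable_pi_apply t
  law v := (h.process v).map_eq t

/-- The event that the configuration at time `t` stabilizes. -/
def stableEvent {n : ℕ} {Ω : Type*} (N : FlowerVertex n → ℝ≥0 → Ω → ℕ) (t : ℝ≥0) : Set Ω :=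
  {ω | Stabilizes (flower n) fun v => N v t ω}

lemma mem_stableEvent_iff {n : ℕ} {Ω : Type*} {N : FlowerVertex n → ℝ≥0 → Ω → ℕ} {t : ℝ≥0}
    {ω : Ω} : ω ∈ stableEvent N t ↔ N none t ω + (petalTotal fun v => N (some v) t ω)
      < 3 * n + balanced fun v => N (some v) t ω :=
  stabilizes_flower_iff _

section Single

variable {n : ℕ} {Ω : Type*} [MeasurableSpace Ω] {P : Measure Ω}
  {N : FlowerVertex n → ℝ≥0 → Ω → ℕ}

lemma IsPoissonFamily.measurableSet_stableEvent (hN : IsPoissonFamily P N) (t : ℝ≥0) :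
    MeasurableSet (stableEvent N t) := by
  have h : Measurable fun ω v => N v t ω :=
    measurable_pi_lambda _ fun v => (hN.process v).measurable t
  exact h (.of_discrete (s := {η | Stabilizes (flower n) η}))

lemma IsPoissonFamily.antitone_stableEvent (hN : IsPoissonFamily P N) :
    ∀ᵐ ω ∂P, Antitone fun t => ω ∈ stableEvent N t := by
  filter_upwards [ae_all_iff.2 fun v => (hN.process v).mono] with ω hω s t hst h
  rw [mem_stableEvent_iff] at h ⊢
  have h₁ := petalTotal_add_balanced_le (p := fun v => N (some v) s ω)
    (q := fun v => N (some v) t ω) fun v => hω (some v) hst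
  have h₂ : N none s ω ≤ N none t ω := hω none hst
  omega

variable [IsProbabilityMeasure P]

/-- An exponential bound for the probability that the configuration at time `t` stabilizes. -/
lemma IsPoissonFamily.measure_stableEvent_le (hN : IsPoissonFamily P N) (hn : 0 < n) (t : ℝ≥0) :
    P (stableEvent N t) ≤ ENNReal.ofReal (Real.exp (4 - t / 2)) := by
  -- Up to time 8 the claimed bound is at least 1.
  obtain ht | ht := le_or_gt (t : ℝ) 8
  · refine prob_le_one.trans ?_
    rw [← ENNReal.ofReal_one]
    exact ENNReal.ofReal_le_ofReal (Real.one_le_exp (by linarith))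
  have hU := hN.isPoissonHeights t
  let X : FlowerVertex n → Ω → ℝ := fun v ω => N v t ω
  have hX : ∀ v, Measurable (X v) := fun v => measurable_from_top.comp (hU.measurable v)
  have hind : iIndepFun X P := hU.indep.comp (fun _ k => (k : ℝ)) fun _ => measurable_from_top
  have hmgf : ∀ v, mgf (X v) P (-1) = Real.exp (t * (Real.exp (-1) - 1)) := by
    intro v
    rw [← mgf_poisson, ← hU.law v, mgf_map (hU.measurable v).aemeasurable .of_discrete]
    rfl
  have hsub : stableEvent N t ⊆ {ω | (∑ v, X v) ω ≤ 4 * n} := by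
    intro ω hω
    rw [mem_stableEvent_iff] at hω
    have hb := balanced_le_card fun v => N (some v) t ω
    rw [Fintype.card_fin] at hb
    simp only [X, Finset.sum_apply, Set.mem_ofPred_eq, Fintype.sum_option, Fintype.sum_prod_type,
      Fintype.sum_bool]
    rw [petalTotal, Finset.sum_congr rfl fun i _ => add_comm _ _] at hω
    exact_mod_cast (by omega : N none t ω + ∑ i, (N (some (i, true)) t ω
      + N (some (i, false)) t ω) ≤ 4 * n)
  have hint : Integrable (fun ω => Real.exp (-1 * (∑ v, X v) ω)) P := by
    refine Integrable.of_bound (C := 1) (by fun_prop) (.of_forall fun ω => ?_)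
    rw [Real.norm_eq_abs, Real.abs_exp, Real.exp_le_one_iff, Finset.sum_apply]
    have : 0 ≤ ∑ v, X v ω := Finset.sum_nonneg fun v _ => Nat.cast_nonneg _
    linarith
  -- Chernoff bound with parameter -1: stabilization forces at most `4n` particles, while the `2n +
  -- 1` heights have mean `t` each. With `exp(-1) ≤ 1/2` the exponent is at most `4n - (2n+1)t/2`,
  -- hence at most `4 - t/2`, uniformly in `n ≥ 1`.
  have key := measure_le_le_exp_mul_mgf (μ := P) (4 * n) (by norm_num : (-1 : ℝ) ≤ 0) hint
  rw [hind.mgf_sum hX, Finset.prod_congr rfl fun v _ => hmgf v, Finset.prod_const,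
    ← Real.exp_nat_mul, ← Real.exp_add] at key
  refine (measure_mono hsub).trans ?_
  rw [← ofReal_measureReal]
  refine ENNReal.ofReal_le_ofReal (key.trans (Real.exp_le_exp.2 ?_))
  have hcard : ((Finset.univ : Finset (FlowerVertex n)).card : ℝ) = 2 * n + 1 := by
    simp [mul_comm]
  have he : Real.exp (-1) ≤ 1 / 2 := by
    rw [Real.exp_neg, one_div]
    exact inv_anti₀ (by norm_num) (by linarith [Real.add_one_le_exp 1])
  have hn1 : (1 : ℝ) ≤ n := by exact_mod_cast hn
  rw [hcard]
  have h₁ : (2 * n + 1 : ℝ) * (t * (Real.exp (-1) - 1)) ≤ (2 * n + 1) * (t * (1 / 2 - 1)) := by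
    gcongr
  nlinarith

lemma IsPoissonFamily.ae_lastTime_ne_top (hN : IsPoissonFamily P N) (hn : 0 < n) :
    ∀ᵐ ω ∂P, lastTime (stableEvent N) ω ≠ ∞ := by
  refine Sandpile.ae_lastTime_ne_top hN.antitone_stableEvent ?_
  refine tendsto_of_tendsto_of_tendsto_of_le_of_le tendsto_const_nhds ?_ (fun _ => zero_le)
    fun k => hN.measure_stableEvent_le hn k
  have h : Tendsto (fun k : ℕ => Real.exp (4 - (k : ℝ) / 2)) atTop (𝓝 0) :=
    Real.tendsto_exp_atBot.comp <| tendsto_atBot_add_const_left _ _ <|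
      tendsto_neg_atTop_atBot.comp <| tendsto_natCast_atTop_atTop.atTop_div_const two_pos
  simpa using ENNReal.tendsto_ofReal h

end Single

variable {Ω : ℕ → Type*} [∀ n, MeasurableSpace (Ω n)] {P : ∀ n, Measure (Ω n)}
  [∀ n, IsProbabilityMeasure (P n)] {N : ∀ n, FlowerVertex n → ℝ≥0 → Ω n → ℕ}

lemma tendsto_measure_stableEvent_zero (hN : ∀ n, IsPoissonFamily (P n) (N n)) {t : ℝ≥0}
    (ht : densityCurve t < t) : Tendsto (fun n => P n (stableEvent (N n) t)) atTop (𝓝 0) := by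
  have hδ : 0 < t - densityCurve t := sub_pos.2 ht
  have h := (tendsto_measure_total (fun n => (hN n).isPoissonHeights t) hδ).add
    (tendsto_measure_balanced (fun n => (hN n).isPoissonHeights t) hδ)
  rw [add_zero] at h
  refine tendsto_of_tendsto_of_tendsto_of_le_of_le tendsto_const_nhds h (fun _ => zero_le)
    fun n => (measure_mono fun ω hω => ?_).trans (measure_union_le _ _)
  rw [mem_stableEvent_iff, ← @Nat.cast_lt ℝ] at hω
  simp only [Set.mem_ofPred_eq, Set.mem_union]
  by_contra! hcon
  rw [abs_lt, abs_lt] at hcon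
  have h3 := congrArg (· * (n : ℝ)) (three_add_balancedProb t)
  push_cast at hω hcon
  linarith [hcon.1.1, hcon.2.2]

lemma tendsto_measure_stableEvent_one (hN : ∀ n, IsPoissonFamily (P n) (N n)) {t : ℝ≥0}
    (ht : t < densityCurve t) : Tendsto (fun n => P n (stableEvent (N n) t)) atTop (𝓝 1) := by
  have hδ : 0 < densityCurve t - t := sub_pos.2 ht
  have h := (tendsto_measure_total (fun n => (hN n).isPoissonHeights t) hδ).add
    (tendsto_measure_balanced (fun n => (hN n).isPoissonHeights t) hδ)
  rw [add_zero] at h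
  have hc : Tendsto (fun n => P n (stableEvent (N n) t)ᶜ) atTop (𝓝 0) := by
    refine tendsto_of_tendsto_of_tendsto_of_le_of_le tendsto_const_nhds h (fun _ => zero_le)
      fun n => (measure_mono fun ω hω => ?_).trans (measure_union_le _ _)
    rw [Set.mem_compl_iff, mem_stableEvent_iff, not_lt, ← @Nat.cast_le ℝ] at hω
    simp only [Set.mem_ofPred_eq, Set.mem_union]
    by_contra! hcon
    rw [abs_lt, abs_lt] at hcon
    have h3 := congrArg (· * (n : ℝ)) (three_add_balancedProb t)
    push_cast at hω hcon
    linarith [hcon.1.2, hcon.2.1]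
  have h1 := ENNReal.Tendsto.sub (tendsto_const_nhds (x := (1 : ℝ≥0∞))) hc (by simp)
  rw [tsub_zero] at h1
  refine h1.congr fun n => ?_
  rw [prob_compl_eq_one_sub ((hN n).measurableSet_stableEvent t),
    ENNReal.sub_sub_cancel ENNReal.one_ne_top prob_le_one]

theorem tendsto_thresholdDensity (hN : ∀ n, IsPoissonFamily (P n) (N n)) {z : ℝ}
    (hcurve : densityCurve z = z) :
    Tendsto (fun n => thresholdDensity (flower n) (P n) (N n)) atTop (𝓝 (ENNReal.ofReal z)) := by
  have hmono := strictMono_sub_densityCurve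
  have hlt : ∀ t : ℝ, t < z → t < densityCurve t := fun t ht => by
    have := hmono ht
    simp only [hcurve, sub_self] at this
    linarith
  have hgt : ∀ t : ℝ, z < t → densityCurve t < t := fun t ht => by
    have := hmono ht
    simp only [hcurve, sub_self] at this
    linarith
  -- By the layer-cake formula the expectation is the integral of the tail probabilities. These
  -- converge to this indicator except possibly at `t = z`, so dominated convergence finishes the
  -- proof.
  have hlim : ∫⁻ t in Set.Ioi (0 : ℝ), (Set.Iio z).indicator 1 t = ENNReal.ofReal z := by
    rw [lintegral_indicator_one measurableSet_Iio, Measure.restrict_apply measurableSet_Iio,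
      Set.Iio_inter_Ioi, Real.volume_Ioo, sub_zero]
  have heq : ∀ᶠ n in atTop, ∫⁻ t in Set.Ioi (0 : ℝ),
      P n {ω | t < (lastTime (stableEvent (N n)) ω).toReal}
        = thresholdDensity (flower n) (P n) (N n) := by
    filter_upwards [eventually_gt_atTop 0] with n hn
    exact (lintegral_lastTime (hN n).measurableSet_stableEvent (hN n).antitone_stableEvent
      ((hN n).ae_lastTime_ne_top hn)).symm
  rw [← hlim]
  refine Tendsto.congr' heq ?_
  refine tendsto_lintegral_filter_of_dominated_convergence
    (fun t => ENNReal.ofReal (Real.exp (4 - t / 2))) (.of_forall fun n => ?_) ?_ ?_ ?_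
  · exact Antitone.measurable fun s t hst => measure_mono fun ω hω => hst.trans_lt hω
  · filter_upwards [eventually_gt_atTop 0] with n hn
    filter_upwards [ae_restrict_mem measurableSet_Ioi] with t ht
    lift t to ℝ≥0 using le_of_lt ht
    exact (measure_lt_lastTime_le (hN n).antitone_stableEvent t).trans
      ((hN n).measure_stableEvent_le hn t)
  · have hint : IntegrableOn (fun t : ℝ => Real.exp (4 - t / 2)) (Set.Ioi 0) := by
      have := (integrableOn_exp_mul_Ioi (by norm_num : -(1 / 2 : ℝ) < 0) 0).const_mul (Real.exp 4)
      refine IntegrableOn.congr_fun this (fun t _ => ?_) measurableSet_Ioi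
      rw [← Real.exp_add]
      ring_nf
    exact hint.lintegral_lt_top.ne
  · have hne : ∀ᵐ t : ℝ ∂(volume.restrict (Set.Ioi 0)), t ≠ z :=
      ae_restrict_of_ae (Measure.ae_ne volume z)
    filter_upwards [hne, ae_restrict_mem measurableSet_Ioi] with t htz ht
    lift t to ℝ≥0 using le_of_lt ht
    obtain h | h := lt_or_gt_of_ne htz
    · rw [Set.indicator_of_mem (Set.mem_Iio.2 h), Pi.one_apply]
      obtain ⟨s, hts, hsz⟩ := exists_between h
      lift s to ℝ≥0 using t.2.trans hts.le
      refine tendsto_of_tendsto_of_tendsto_of_le_of_le' (tendsto_measure_stableEvent_one hN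
        (hlt s hsz)) tendsto_const_nhds ?_ (.of_forall fun n => prob_le_one)
      filter_upwards [eventually_gt_atTop 0] with n hn
      exact le_measure_lt_lastTime ((hN n).ae_lastTime_ne_top hn) hts
    · rw [Set.indicator_of_notMem (Set.notMem_Iio.2 (le_of_lt h))]
      exact tendsto_of_tendsto_of_tendsto_of_le_of_le tendsto_const_nhds
        (tendsto_measure_stableEvent_zero hN (hgt t h)) (fun _ => zero_le)
        fun n => measure_lt_lastTime_le (hN n).antitone_stableEvent t

omit [∀ n, IsProbabilityMeasure (P n)] in
lemma aemeasurable_randomThreshold (hN : ∀ n, IsPoissonFamily (P n) (N n)) (n : ℕ) :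
    AEMeasurable (randomThreshold (flower n) (N n)) (P n) :=
  aemeasurable_lastTime (hN n).measurableSet_stableEvent (hN n).antitone_stableEvent

end ThresholdDensity

end Sandpile

theorem mainTheorem6 :
    ∃ ζc : ℝ,
      -- `ζc` is the unique positive root of `ζ = 5/3 + (1/3) exp (-3ζ)`
      (∀ z : ℝ, (0 < z ∧ z = 5 / 3 + 1 / 3 * Real.exp (-3 * z)) ↔ z = ζc) ∧
      -- the threshold density of `F_n` tends to `ζc`
      (∀ (Ω : ℕ → Type*) [∀ n, MeasurableSpace (Ω n)] (P : ∀ n, Measure (Ω n))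
          [∀ n, IsProbabilityMeasure (P n)] (N : ∀ n, Sandpile.FlowerVertex n → ℝ≥0 → Ω n → ℕ),
          (∀ n, Sandpile.IsPoissonFamily (P n) (N n)) →
          (∀ n, AEMeasurable (Sandpile.randomThreshold (Sandpile.flower n) (N n)) (P n)) ∧
          Tendsto (fun n => Sandpile.thresholdDensity (Sandpile.flower n) (P n) (N n)) atTop
            (𝓝 (ENNReal.ofReal ζc))) ∧
      -- the stationary density of the flower graph with a sink petal tends to `5/3`
      Tendsto (fun n => Sandpile.stationaryDensity (Sandpile.flower n) (Sandpile.flowerSinks n))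
        atTop (𝓝 (5 / 3)) ∧
      -- the final density converges in probability
      (∀ r : ℝ≥0, 0 < r → ∃ ρ : ℝ,
          ρ = min (r : ℝ) (5 / 3 + 1 / 3 * Real.exp (-3 * (r : ℝ))) ∧
          ((r : ℝ) ≤ ζc → ρ = r) ∧
          (ζc < (r : ℝ) → ρ = 5 / 3 + 1 / 3 * Real.exp (-3 * (r : ℝ))) ∧
          ∀ ε : ℝ, 0 < ε →
            Tendsto (fun n => Sandpile.poissonConfig (Sandpile.flowerSinks n) r
                {σ | ε ≤ |Sandpile.finalDensity (Sandpile.flower n) (Sandpile.flowerSinks n) σ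
                  - ρ|})
              atTop (𝓝 0)) := by
  obtain ⟨ζc, hpos, hζ⟩ := Sandpile.exists_densityCurve_eq
  have hmono := Sandpile.strictMono_sub_densityCurve
  refine ⟨ζc, fun z => ⟨fun hz => ?_, ?_⟩, fun Ω _ P _ N hN => ⟨?_, ?_⟩,
    Sandpile.tendsto_stationaryDensity, fun r _ => ⟨_, rfl, fun h => ?_, fun h => ?_, ?_⟩⟩
  · refine hmono.injective ?_
    simp only [hζ, sub_self]
    exact sub_eq_zero.2 hz.2
  · rintro rfl
    exact ⟨hpos, hζ.symm⟩
  · exact Sandpile.aemeasurable_randomThreshold hN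
  · exact Sandpile.tendsto_thresholdDensity hN hζ
  · have := hmono.monotone h
    simp only [hζ, sub_self] at this
    simp only [Sandpile.densityCurve] at this
    exact min_eq_left (by linarith)
  · have := hmono h
    simp only [hζ, sub_self] at this
    simp only [Sandpile.densityCurve] at this
    exact min_eq_right (by linarith)
  · exact fun ε hε => Sandpile.tendsto_finalDensity r hε
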